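/- \textbf{Systems and trees.} A (finite) multi-agent system $M=(Q,Ag,\delta,q_0,\Pi,(\Pi_a)_{a\in Ag},\pi)$ consists of finite sets $Q$ (states), $Ag$ (agents), $\Pi$ (atomic propositions), a transition relation $\delta\subseteq Q\times Q$, an initial state $q_0\in Q$, sets $\Pi_a\subseteq\Pi$ of propositions observed by agent $a$, and a labelling $\pi:Q\to 2^{\Pi}$. The nodes of its tree unfolding $t_M$ are the words $x=q_1\cdots q_r$ ($r\ge 0$) over $Q$ with $(q_{i},q_{i+1})\in\delta$ for $0\le i<r$; the node $x$ is labelled with the state $q_r$, the root is the empty word $\varepsilon$, labelled with $q_0$, and the successors of $x$ are the nodes $xq$ with $q\in Q$. For nodes $x=q_1\cdots q_r$ and $y=q_1'\cdots q'_s$ put $x\sim_a y$ iff $r=s$ and $\pi(q_i)\cap\Pi_a=\pi(q_i')\cap\Pi_a$ for all $i\le r$ (synchronous perfect recall). \textbf{Formulas.} With $p\in\Pi$, $a\in Ag$ and $Z$ in a finite set of second-order variables, the formulas of the $\mu$-calculus of knowledge are $$\varphi ::= p\mid\neg p\mid Z\mid\varphi\wedge\varphi\mid\varphi\vee\varphi\mid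 AX\varphi\mid EX\varphi\mid K_a\varphi\mid P_a\varphi\mid\mu Z.\varphi\mid\nu Z.\varphi .$$ In the tree semantics a formula denotes, for each assignment of sets of nodes of $t_M$ to the variables, a set of nodes: $p$, $\neg p$ hold at the nodes whose state has, respectively lacks, $p$ in its label; $\wedge,\vee$ are intersection and union; $AX\varphi$ ($EX\varphi$) holds at $x$ iff $\varphi$ holds at all (some) successors of $x$; $K_a\varphi$ ($P_a\varphi$) holds at $x$ iff $\varphi$ holds at all (some) nodes $y\sim_a x$; $\mu Z.\varphi$ and $\nu Z.\varphi$ are the least and greatest fixpoints of the monotone map given by $\varphi$ as a function of the value of $Z$. A formula is closed if every occurrence of a variable $Z$ in it lies in the scope of a fixpoint operator for $Z$. For closed $\varphi$, write $t_M\models\varphi$ if the root $\varepsilon$ belongs to the set denoted by $\varphi$. \textbf{The fragment.} For a node $x$ of the syntax tree of $\varphi$ let $form(x)$ be the subformula at $x$. An operator $K_a$ or $P_a$ is non-closed at $x$ if it labels some descendant $y$ of $x$ (possibly $y=x$) such that $form(y')$ is not closed for every node $y'$ on the path from $x$ to $y$, both ends included. The formula $\varphi$ is non-mixing if any two agents $a,b$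 that have operators which are both non-closed at a common node of the syntax tree satisfy $\Pi_a\subseteq\Pi_b$ or $\Pi_b\subseteq\Pi_a$. \textbf{Theorem.} The model-checking problem for the $\mu$-calculus of non-mixing epistemic fixpoints is decidable: there is an algorithm which, given a finite multi-agent system $M$ and a closed non-mixing formula $\varphi$ over its agents and propositions, decides whether $t_M\models\varphi$. -/

import Mathlib

namespace EpistemicMu

/-- A multi-agent system with states `Q`, agents `Ag` and atomic propositions `P`: a transition
relation, an initial state, for every agent the set of propositions it observes, and for every
state the set of propositions that hold there. -/
structure MAS (Q Ag P : Type) where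
  trans : Q → Q → Prop
  init : Q
  obs : Ag → Set P
  label : Q → Set P

/-- Formulas (in positive form) of the mu-calculus of knowledge, with agents `Ag`, atomic
propositions `P` and second-order variables `V`. -/
inductive Formula (Ag P V : Type) where
  | prop (p : P)
  | negProp (p : P)
  | var (Z : V)
  | and (φ ψ : Formula Ag P V)
  | or (φ ψ : Formula Ag P V)
  | AX (φ : Formula Ag P V)
  | EX (φ : Formula Ag P V)
  | know (a : Ag) (φ : Formula Ag P V)
  | poss (a : Ag) (φ : Formula Ag P V)
  | mu (Z : V) (φ : Formula Ag P V)
  | nu (Z : V) (φ : Formula Ag P V)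

namespace MAS

variable {Q Ag P : Type} (M : MAS Q Ag P)

/-- The nodes of the tree unfolding of `M`: the words `x` of states such that `init x` is a finite
run of `M`. -/
def Node : Type := {x : List Q // List.IsChain M.trans (M.init :: x)}

/-- The state that labels a node: its last letter, and the initial state at the root. -/
def Node.state {M : MAS Q Ag P} (x : M.Node) : Q :=
  (M.init :: x.1).getLast (List.cons_ne_nil _ _)

/-- The root (the empty word) of the tree unfolding. -/
def root : M.Node := ⟨[], List.isChain_singleton _⟩

/-- `y` is a successor of `x` in the tree unfolding. -/
def Succ (x y : M.Node) : Prop := ∃ q : Q, y.1 = x.1 ++ [q]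

/-- What agent `a` has observed along the path from the root to `x`. -/
def observations (a : Ag) (x : M.Node) : List (Set P) :=
  (M.init :: x.1).map (fun q => M.label q ∩ M.obs a)

/-- Synchronous perfect-recall indistinguishability of two nodes (equality of the two lists
contains equality of the lengths). -/
def Indist (a : Ag) (x y : M.Node) : Prop := M.observations a x = M.observations a y

/-- Two agents have compatible observability if their observation sets are nested. -/
def Compatible (a b : Ag) : Prop := M.obs a ⊆ M.obs b ∨ M.obs b ⊆ M.obs a

end MAS

namespace Formula

variable {Q Ag P V : Type}

theorem update_mono [DecidableEq V] {α : Type} {ρ σ : V → Set α} {S T : Set α} (hρ : ρ ≤ σ)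
    (hS : S ≤ T) (Z : V) : Function.update ρ Z S ≤ Function.update σ Z T := by
  intro Y
  by_cases h : Y = Z
  · subst h
    simpa using hS
  · simpa [h] using hρ Y

/-- The tree semantics of a formula over the tree unfolding of `M`: a monotone set transformer,
sending an assignment of sets of nodes to the variables to a set of nodes. -/
def sem [DecidableEq V] (M : MAS Q Ag P) : Formula Ag P V → ((V → Set M.Node) →o Set M.Node)
  | prop p => ⟨fun _ => {x | p ∈ M.label x.state}, fun _ _ _ => le_rfl⟩
  | negProp p => ⟨fun _ => {x | p ∉ M.label x.state}, fun _ _ _ => le_rfl⟩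
  | var Z => ⟨fun ρ => ρ Z, fun _ _ h => h Z⟩
  | and φ ψ => ⟨fun ρ => sem M φ ρ ∩ sem M ψ ρ, fun _ _ h =>
      Set.inter_subset_inter ((sem M φ).monotone h) ((sem M ψ).monotone h)⟩
  | or φ ψ => ⟨fun ρ => sem M φ ρ ∪ sem M ψ ρ, fun _ _ h =>
      Set.union_subset_union ((sem M φ).monotone h) ((sem M ψ).monotone h)⟩
  | AX φ => ⟨fun ρ => {x | ∀ y, M.Succ x y → y ∈ sem M φ ρ}, fun _ _ h _ hx y hy =>
      (sem M φ).monotone h (hx y hy)⟩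
  | EX φ => ⟨fun ρ => {x | ∃ y, M.Succ x y ∧ y ∈ sem M φ ρ}, fun _ _ h _ hx =>
      hx.imp fun _ hy => ⟨hy.1, (sem M φ).monotone h hy.2⟩⟩
  | know a φ => ⟨fun ρ => {x | ∀ y, M.Indist a x y → y ∈ sem M φ ρ}, fun _ _ h _ hx y hy =>
      (sem M φ).monotone h (hx y hy)⟩
  | poss a φ => ⟨fun ρ => {x | ∃ y, M.Indist a x y ∧ y ∈ sem M φ ρ}, fun _ _ h _ hx =>
      hx.imp fun _ hy => ⟨hy.1, (sem M φ).monotone h hy.2⟩⟩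
  | mu Z φ =>
      ⟨fun ρ => OrderHom.lfp ⟨fun S => sem M φ (Function.update ρ Z S), fun _ _ h =>
          (sem M φ).monotone (update_mono le_rfl h Z)⟩,
        fun _ _ h => OrderHom.lfp.monotone fun _ =>
          (sem M φ).monotone (update_mono h le_rfl Z)⟩
  | nu Z φ =>
      ⟨fun ρ => OrderHom.gfp ⟨fun S => sem M φ (Function.update ρ Z S), fun _ _ h =>
          (sem M φ).monotone (update_mono le_rfl h Z)⟩,
        fun _ _ h => OrderHom.gfp.monotone fun _ =>
          (sem M φ).monotone (update_mono h le_rfl Z)⟩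

/-- The variables with an occurrence outside the scope of every fixpoint operator for them. -/
def freeVars : Formula Ag P V → Set V
  | prop _ => ∅
  | negProp _ => ∅
  | var Z => {Z}
  | and φ ψ => freeVars φ ∪ freeVars ψ
  | or φ ψ => freeVars φ ∪ freeVars ψ
  | AX φ => freeVars φ
  | EX φ => freeVars φ
  | know _ φ => freeVars φ
  | poss _ φ => freeVars φ
  | mu Z φ => freeVars φ \ {Z}
  | nu Z φ => freeVars φ \ {Z}

/-- A formula is closed if it has no free variable. -/
def Closed (φ : Formula Ag P V) : Prop := φ.freeVars = ∅

/-- `M` satisfies `φ` in the tree semantics: the root of the unfolding lies in the value of `φ`,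
whatever the values of the variables (they are irrelevant for closed `φ`). -/
def Holds [DecidableEq V] (M : MAS Q Ag P) (φ : Formula Ag P V) : Prop :=
  ∀ ρ : V → Set M.Node, M.root ∈ φ.sem M ρ

/-- The formulas at the immediate successors of the root of the syntax tree. -/
def children : Formula Ag P V → List (Formula Ag P V)
  | prop _ => []
  | negProp _ => []
  | var _ => []
  | and φ ψ => [φ, ψ]
  | or φ ψ => [φ, ψ]
  | AX φ => [φ]
  | EX φ => [φ]
  | know _ φ => [φ]
  | poss _ φ => [φ]
  | mu _ φ => [φ]
  | nu _ φ => [φ]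

/-- `SubformulaOf ψ φ`: `ψ` is the formula at some node of the syntax tree of `φ`. -/
def SubformulaOf (ψ φ : Formula Ag P V) : Prop :=
  Relation.ReflTransGen (fun χ θ : Formula Ag P V => θ ∈ χ.children) φ ψ

/-- `NonClosedOp φ a`: one of the operators `K_a`, `P_a` is non-closed at the root of the syntax
tree of `φ`, i.e. it labels a node `y` such that the formulas at all nodes on the path from the
root to `y`, both ends included, are not closed. -/
inductive NonClosedOp : Formula Ag P V → Ag → Prop
  | know (a : Ag) (φ : Formula Ag P V) (h : ¬ (know a φ).Closed) : NonClosedOp (know a φ) a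
  | poss (a : Ag) (φ : Formula Ag P V) (h : ¬ (poss a φ).Closed) : NonClosedOp (poss a φ) a
  | step (φ ψ : Formula Ag P V) (a : Ag) (h : ¬ φ.Closed) (hψ : ψ ∈ φ.children)
      (hψa : NonClosedOp ψ a) : NonClosedOp φ a

/-- Non-mixing formulas: any two agents with operators that are both non-closed at a common node
of the syntax tree have compatible observability. -/
def NonMixing (M : MAS Q Ag P) (φ : Formula Ag P V) : Prop :=
  ∀ ψ : Formula Ag P V, SubformulaOf ψ φ →
    ∀ a b : Ag, NonClosedOp ψ a → NonClosedOp ψ b → M.Compatible a b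

/-- A formula in Polish (prefix) notation; every symbol is a pair of an operation code and an
index (0 where there is no index). -/
def encode {k m v : ℕ} : Formula (Fin k) (Fin m) (Fin v) → List (ℕ × ℕ)
  | prop p => [(0, p)]
  | negProp p => [(1, p)]
  | var Z => [(2, Z)]
  | and φ ψ => (3, 0) :: (encode φ ++ encode ψ)
  | or φ ψ => (4, 0) :: (encode φ ++ encode ψ)
  | AX φ => (5, 0) :: encode φ
  | EX φ => (6, 0) :: encode φ
  | know a φ => (7, a) :: encode φ
  | poss a φ => (8, a) :: encode φ
  | mu Z φ => (9, Z) :: encode φ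
  | nu Z φ => (10, Z) :: encode φ

end Formula

/-- The Boolean matrix of a relation between finite sets, as the list of its rows. -/
noncomputable def matrixOf {m n : ℕ} (R : Fin m → Fin n → Prop) : List (List Bool) :=
  open Classical in List.ofFn fun i => List.ofFn fun j => decide (R i j)

/-- A finite system as finite data: the numbers of states, agents and propositions, the number of
the initial state, and the matrices of the transition relation, of the observation sets and of the
labelling. -/
noncomputable def MAS.encode {n k m : ℕ} (M : MAS (Fin n) (Fin k) (Fin m)) :
    (ℕ × ℕ × ℕ × ℕ) × List (List Bool) × List (List Bool) × List (List Bool) :=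
  ((n, k, m, M.init), matrixOf M.trans, matrixOf (fun a p => p ∈ M.obs a),
    matrixOf (fun q p => p ∈ M.label q))

/-- Finite data that an algorithm for the model-checking problem gets as its input: a coded system,
a number of variables, a coded formula. -/
abbrev Input : Type :=
  ((ℕ × ℕ × ℕ × ℕ) × List (List Bool) × List (List Bool) × List (List Bool)) ×
    ℕ × List (ℕ × ℕ)

end EpistemicMu

/-!
The algorithm replaces every fixpoint of the formula by a stage of its iteration whose index is
computed from the input, and evaluates the resulting fixpoint-free formula, which only depends on
the nodes up to a depth bounded by its size.

That a computable number of iterations suffices rests on finite bisimulation quotients of the tree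
unfolding. A colouring of the nodes by finitely many colours is *stable* if its kernel is a
bisimulation for the states and the successor relation. Refining a stable colouring by the set of
colours that an agent `a` considers possible (`MAS.refine`) gives a stable colouring with at most
`growth` many colours. Refining with pairwise compatible agents, from the best informed to the
least informed one, gives a kernel that is a bisimulation for the indistinguishability relations of
all of them at once: a step for a less informed agent is constant on the classes of the better
informed ones, and does not destroy what was achieved for them (`MAS.respects_refine`,
`MAS.exists_respects`). For incompatible agents this fails.

In a formula whose operators are all respected by a stable colouring `e`, every operation preserves
`e`-invariant sets, so that a fixpoint is reached after as many iterations as there are colours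
(`MAS.lfp_eq_iterate`). The values of closed subformulas do not depend on the variables, so it is
enough that they are invariant under a coarser colouring; only the agents with non-closed operators
need to be respected simultaneously, and these are pairwise compatible in a non-mixing formula. By
induction on the formula there is a fine enough colouring with a number of colours bounded by
iterated `growth` (`Formula.attainable_fineEnough`, `Formula.approx_eq_sem`).

The algorithm works on formulas in Polish notation, read from the right with a stack, and on lists
of nodes. Correctness is `modelCheck_encode`; all ingredients are primitive recursive
(`primrec_modelCheck`).
-/

namespace EpistemicMu

variable {Q Ag P V : Type}

/-! ### Stable colourings of the tree -/

namespace MAS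

variable {M : MAS Q Ag P} {α β γ : Type}

theorem Succ.state_eq {x x' : M.Node} {q : Q} (h : x'.1 = x.1 ++ [q]) : x'.state = q := by
  simp [Node.state, h]

theorem isChain_append_iff (x : M.Node) (q : Q) :
    List.IsChain M.trans (M.init :: (x.1 ++ [q])) ↔ M.trans x.state q := by
  have hx : List.IsChain M.trans (M.init :: x.1) := x.2
  rw [← List.cons_append, List.isChain_append,
    List.getLast?_eq_getLast_of_ne_nil (List.cons_ne_nil _ _)]
  simp [hx, Node.state]

theorem Succ.indist_iff {a : Ag} {x x' y y' : M.Node} (hx : M.Succ x x') (hy : M.Succ y y') :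
    M.Indist a x' y' ↔
      M.Indist a x y ∧ M.label x'.state ∩ M.obs a = M.label y'.state ∩ M.obs a := by
  obtain ⟨q, hq⟩ := hx
  obtain ⟨r, hr⟩ := hy
  rw [Succ.state_eq hq, Succ.state_eq hr]
  simp only [Indist, observations, hq, hr, ← List.cons_append, List.map_append]
  constructor
  · intro h
    obtain ⟨h₁, h₂⟩ := List.append_inj' h (by simp)
    exact ⟨h₁, by simpa using h₂⟩
  · rintro ⟨h₁, h₂⟩
    rw [h₁, List.map_singleton, List.map_singleton, h₂]

theorem Indist.exists_pred {a : Ag} {x x' y' : M.Node} (hx : M.Succ x x')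
    (h : M.Indist a x' y') : ∃ y, M.Succ y y' := by
  obtain ⟨q, hq⟩ := hx
  obtain ⟨l, hl⟩ := y'
  have hlen : l.length = x.1.length + 1 := by
    have := congrArg List.length h
    simp [observations, hq] at this
    omega
  rcases List.eq_nil_or_concat l with rfl | ⟨l', r, rfl⟩
  · simp at hlen
  · refine ⟨⟨l', ?_⟩, r, by simp⟩
    have := hl
    rw [List.concat_eq_append, ← List.cons_append] at this
    exact this.left_of_append

/-- A colouring of the nodes of the tree is stable if its kernel is a bisimulation for the states
and the successor relation. -/
structure Stable (c : M.Node → α) : Prop where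
  state {x y : M.Node} : c x = c y → x.state = y.state
  succ {x y x' : M.Node} : c x = c y → M.Succ x x' → ∃ y', M.Succ y y' ∧ c x' = c y'

/-- The kernel of the colouring is a bisimulation for the indistinguishability of agent `a`. -/
def Respects (c : M.Node → α) (a : Ag) : Prop :=
  ∀ ⦃x y x' : M.Node⦄, c x = c y → M.Indist a x x' → ∃ y', M.Indist a y y' ∧ c x' = c y'

/-- Membership in `S` depends on the colour only. -/
def Invariant (c : M.Node → α) (S : Set M.Node) : Prop :=
  ∀ ⦃x y : M.Node⦄, c x = c y → x ∈ S → y ∈ S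

/-- The colouring `d` refines the colouring `c`. -/
def Finer (d : M.Node → β) (c : M.Node → α) : Prop :=
  ∀ ⦃x y : M.Node⦄, d x = d y → c x = c y

/-- The colours that agent `a` considers possible at `x`. -/
def possibleColours (c : M.Node → α) (a : Ag) (x : M.Node) : Set α :=
  {s | ∃ y, M.Indist a x y ∧ c y = s}

/-- The refinement of a colouring by the information that agent `a` has about it (the subset
construction for `a`). -/
def refine (c : M.Node → α) (a : Ag) (x : M.Node) : α × Set α := (c x, possibleColours c a x)

theorem possibleColours_eq (c : M.Node → α) {a : Ag} {x y : M.Node} (h : M.Indist a x y) :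
    possibleColours c a x = possibleColours c a y := by
  ext s
  exact ⟨fun ⟨z, hz, hs⟩ => ⟨z, h.symm.trans hz, hs⟩, fun ⟨z, hz, hs⟩ => ⟨z, h.trans hz, hs⟩⟩

theorem Invariant.mono {d : M.Node → β} {c : M.Node → α} (h : Finer d c) {S : Set M.Node}
    (hS : Invariant c S) : Invariant d S := fun _ _ hxy hx => hS (h hxy) hx

theorem Finer.trans {e : M.Node → γ} {d : M.Node → β} {c : M.Node → α} (h : Finer e d)
    (h' : Finer d c) : Finer e c := fun _ _ hxy => h' (h hxy)

theorem finer_refine (c : M.Node → α) (a : Ag) : Finer (refine c a) c :=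
  fun _ _ h => (Prod.ext_iff.1 h).1

theorem stable_state (M : MAS Q Ag P) : Stable (M := M) Node.state where
  state h := h
  succ {x y x'} h hx := by
    obtain ⟨q, hq⟩ := hx
    have hx' := x'.2
    rw [hq, isChain_append_iff, h, ← isChain_append_iff] at hx'
    exact ⟨⟨y.1 ++ [q], hx'⟩, ⟨q, rfl⟩,
      (Succ.state_eq hq).trans (Succ.state_eq (x := y) (x' := ⟨y.1 ++ [q], hx'⟩) rfl).symm⟩

theorem Stable.refine {c : M.Node → α} (hc : Stable c) (a : Ag) : Stable (refine c a) where
  state h := hc.state (finer_refine c a h)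
  succ {x y x'} h hx := by
    have key : ∀ {x y x' y' : M.Node}, MAS.refine c a x = MAS.refine c a y → M.Succ x x' →
        M.Succ y y' → c x' = c y' → possibleColours c a x' ⊆ possibleColours c a y' := by
      rintro x y x' y' h hx hy hxy s ⟨z, hz, rfl⟩
      obtain ⟨z₀, hz₀⟩ := Indist.exists_pred hx hz
      obtain ⟨h₁, h₂⟩ := (hx.indist_iff hz₀).1 hz
      have : c z₀ ∈ possibleColours c a y := by
        rw [← show possibleColours c a x = possibleColours c a y from (Prod.ext_iff.1 h).2]
        exact ⟨z₀, h₁, rfl⟩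
      obtain ⟨w₀, hw₀, hcw⟩ := this
      obtain ⟨w, hw, hzw⟩ := hc.succ hcw.symm hz₀
      refine ⟨w, (hy.indist_iff hw).2 ⟨hw₀, ?_⟩, hzw.symm⟩
      rw [← hc.state hxy, h₂, hc.state hzw]
    obtain ⟨y', hy', hxy'⟩ := hc.succ (finer_refine c a h) hx
    exact ⟨y', hy', Prod.ext hxy' ((key h hx hy' hxy').antisymm (key h.symm hy' hx hxy'.symm))⟩

/-- Refining by the least informed agent of a family keeps the bisimulation property for the
better informed ones and adds it for the new agent. -/
theorem respects_refine {c : M.Node → α} {a b : Ag} (hb : b = a ∨ Respects c b)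
    (hab : M.obs a ⊆ M.obs b) : Respects (refine c a) b := by
  have hle : ∀ {x y : M.Node}, M.Indist b x y → M.Indist a x y := by
    intro x y h
    have h' := congrArg (List.map (· ∩ M.obs a)) h
    simpa [observations, Indist, Function.comp_def, Set.inter_assoc,
      Set.inter_eq_self_of_subset_right hab] using h'
  intro x y x' h hx
  obtain ⟨h₁, h₂⟩ := Prod.ext_iff.1 h
  have : ∃ y', M.Indist b y y' ∧ c x' = c y' := by
    rcases hb with rfl | hb
    · have : c x' ∈ possibleColours c b y := by
        rw [← show possibleColours c b x = possibleColours c b y from h₂]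
        exact ⟨x', hx, rfl⟩
      obtain ⟨y', hy', h'⟩ := this
      exact ⟨y', hy', h'.symm⟩
    · exact hb h₁ hx
  obtain ⟨y', hy', hc⟩ := this
  refine ⟨y', hy', Prod.ext hc ?_⟩
  exact (possibleColours_eq c (hle hx)).symm.trans (h₂.trans (possibleColours_eq c (hle hy')))

end MAS

/-- The number of colours of a refined colouring as a function of the number of colours. -/
def growth (t : ℕ) : ℕ := t * 2 ^ t

theorem growth_mono : Monotone growth := fun _ _ h =>
  Nat.mul_le_mul h (Nat.pow_le_pow_right (by norm_num) h)

theorem growth_iterate_le_succ (i t : ℕ) : growth^[i] t ≤ growth^[i + 1] t := by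
  rw [Function.iterate_succ_apply']
  exact Nat.le_mul_of_pos_right _ (by positivity)

theorem growth_iterate_le {i j s t : ℕ} (hij : i ≤ j) (hst : s ≤ t) :
    growth^[i] s ≤ growth^[j] t :=
  (growth_mono.iterate i hst).trans
    (monotone_nat_of_le_succ (fun i => growth_iterate_le_succ i t) hij)

theorem card_prod_set (α : Type) [Finite α] : Nat.card (α × Set α) = growth (Nat.card α) := by
  have := Fintype.ofFinite α
  classical
  simp [growth, Nat.card_eq_fintype_card]

namespace MAS

variable {M : MAS Q Ag P} {α β γ : Type}

/-- Finitely many pairwise compatible agents can be respected simultaneously, by refining with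
them one after the other, from the best informed one to the least informed one. -/
theorem exists_respects [DecidableEq Ag] {c : M.Node → α} [Finite α] (hc : Stable c) (n : ℕ)
    (A : Finset Ag) (hn : A.card = n)
    (hA : ∀ a ∈ A, ∀ b ∈ A, M.Compatible a b) :
    ∃ (β : Type) (_ : Finite β) (d : M.Node → β), Stable d ∧ Finer d c ∧
      Nat.card β ≤ growth^[n] (Nat.card α) ∧ ∀ a ∈ A, Respects d a := by
  induction n generalizing A with
  | zero =>
    obtain rfl := Finset.card_eq_zero.1 hn
    exact ⟨α, ‹_›, c, hc, fun _ _ h => h, le_rfl, by simp⟩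
  | succ n ih =>
    have hne : A.Nonempty := Finset.card_pos.1 (by omega)
    obtain ⟨a, ha, hmin⟩ := A.exists_minimalFor M.obs hne
    have hle : ∀ b ∈ A, M.obs a ⊆ M.obs b := fun b hb =>
      (hA a ha b hb).elim id fun h => hmin hb h
    obtain ⟨β, _, d, hd, hdc, hcard, hr⟩ := ih (A.erase a)
      (by rw [Finset.card_erase_of_mem ha, hn]; rfl)
      fun x hx y hy => hA x (Finset.mem_of_mem_erase hx) y (Finset.mem_of_mem_erase hy)
    refine ⟨β × Set β, inferInstance, refine d a, hd.refine a, (finer_refine d a).trans hdc,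
      ?_, fun b hb => ?_⟩
    · rw [card_prod_set, Function.iterate_succ_apply']
      exact growth_mono hcard
    · refine respects_refine ?_ (hle b hb)
      by_cases h : b = a
      · exact Or.inl h
      · exact Or.inr (hr b (Finset.mem_erase.2 ⟨h, hb⟩))

theorem Invariant.compl {c : M.Node → α} {S : Set M.Node} (h : Invariant c S) : Invariant c Sᶜ :=
  fun _ _ hxy hx hy => hx (h hxy.symm hy)

theorem Invariant.eq_of_image_eq {c : M.Node → α} {S T : Set M.Node} (hS : Invariant c S)
    (hT : Invariant c T) (h : c '' S = c '' T) : S = T := by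
  have key : ∀ {S T : Set M.Node}, Invariant c T → c '' S = c '' T → S ⊆ T := by
    intro S T hT h x hx
    obtain ⟨y, hy, hyx⟩ : c x ∈ c '' T := h ▸ Set.mem_image_of_mem c hx
    exact hT hyx hy
  exact (key hT h).antisymm (key hS h.symm)

/-- An increasing sequence of invariant sets that is constant once it repeats is constant from the
number of colours on. -/
theorem Invariant.stabilizes {c : M.Node → α} [Finite α] {S : ℕ → Set M.Node}
    (hinv : ∀ i, Invariant c (S i)) (hmono : ∀ i, S i ⊆ S (i + 1))
    (hrep : ∀ i, S i = S (i + 1) → S (i + 1) = S (i + 2)) {N : ℕ} (hN : Nat.card α ≤ N) :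
    S N = S (N + 1) := by
  by_contra hne
  have hlt : ∀ i ≤ N, S i ≠ S (i + 1) := by
    intro i hi h
    refine hne ?_
    induction N, hi using Nat.le_induction with
    | base => exact h
    | succ j _ ih =>
      by_cases hj : S j = S (j + 1)
      · exact hrep j hj
      · exact False.elim (hj (Nat.le_induction (m := i) (P := fun j _ => S j = S (j + 1)) h
          (fun j _ => hrep j) j ‹_›))
  have hcard : ∀ i ≤ N + 1, i ≤ (c '' S i).ncard := by
    intro i
    induction i with
    | zero => simp
    | succ i ih =>
      intro hi
      have h₁ := ih (by omega)
      have h₂ : (c '' S i).ncard < (c '' S (i + 1)).ncard := by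
        refine Set.ncard_lt_ncard ?_ (Set.toFinite _)
        refine (Set.image_mono (hmono i)).ssubset_of_ne fun h => ?_
        exact hlt i (by omega) ((hinv i).eq_of_image_eq (hinv (i + 1)) h)
      omega
  have h₁ := hcard (N + 1) le_rfl
  have h₂ := Set.ncard_le_card (c '' S (N + 1))
  omega

/-- If `f` preserves the invariant sets of a colouring with at most `N` colours, its least fixpoint
is reached after `N` iterations and is invariant. -/
theorem lfp_eq_iterate {c : M.Node → α} [Finite α] (f : Set M.Node →o Set M.Node)
    (hf : ∀ S, Invariant c S → Invariant c (f S)) {N : ℕ} (hN : Nat.card α ≤ N) :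
    f^[N] ∅ = f.lfp ∧ Invariant c f.lfp := by
  have hinv : ∀ i, Invariant c (f^[i] ∅) := by
    intro i
    induction i with
    | zero => intro x y _ h; exact h
    | succ i ih => rw [Function.iterate_succ_apply']; exact hf _ ih
  have hmono : ∀ i, f^[i] ∅ ⊆ f^[i + 1] ∅ := fun i => by
    rw [Function.iterate_succ_apply]
    exact f.monotone.iterate i (Set.empty_subset _)
  have hst := Invariant.stabilizes hinv hmono (fun i h => by
    rw [Function.iterate_succ_apply', h, ← Function.iterate_succ_apply' f]) hN
  have hle : ∀ i, f^[i] ∅ ⊆ f.lfp := by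
    intro i
    induction i with
    | zero => exact Set.empty_subset _
    | succ i ih =>
      rw [Function.iterate_succ_apply', ← f.map_lfp]
      exact f.monotone ih
  have : f^[N] ∅ = f.lfp := by
    refine (hle N).antisymm (f.lfp_le ?_)
    rw [← Function.iterate_succ_apply' f]
    exact hst.ge
  exact ⟨this, this ▸ hinv N⟩

theorem gfp_eq_iterate {c : M.Node → α} [Finite α] (f : Set M.Node →o Set M.Node)
    (hf : ∀ S, Invariant c S → Invariant c (f S)) {N : ℕ} (hN : Nat.card α ≤ N) :
    f^[N] Set.univ = f.gfp ∧ Invariant c f.gfp := by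
  have hinv : ∀ i, Invariant c (f^[i] Set.univ) := by
    intro i
    induction i with
    | zero => intro x y _ h; trivial
    | succ i ih => rw [Function.iterate_succ_apply']; exact hf _ ih
  have hmono : ∀ i, f^[i + 1] Set.univ ⊆ f^[i] Set.univ := fun i => by
    rw [Function.iterate_succ_apply]
    exact f.monotone.iterate i (Set.subset_univ _)
  have hst := Invariant.stabilizes (S := fun i => (f^[i] Set.univ)ᶜ) (fun i => (hinv i).compl)
    (fun i => Set.compl_subset_compl.2 (hmono i)) (fun i h => by
    have h := compl_injective h
    rw [Function.iterate_succ_apply', h, ← Function.iterate_succ_apply' f]) hN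
  have hst := compl_injective hst
  have hle : ∀ i, f.gfp ⊆ f^[i] Set.univ := by
    intro i
    induction i with
    | zero => exact Set.subset_univ _
    | succ i ih =>
      rw [Function.iterate_succ_apply', ← f.map_gfp]
      exact f.monotone ih
  have : f^[N] Set.univ = f.gfp := by
    refine Set.Subset.antisymm (f.le_gfp ?_) (hle N)
    rw [← Function.iterate_succ_apply' f]
    exact hst.le
  exact ⟨this, this ▸ hinv N⟩

end MAS

/-! ### Fixpoints by bounded iteration -/

namespace Formula

open MAS

/-- The number of symbols of a formula. -/
def size : Formula Ag P V → ℕ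
  | prop _ => 1
  | negProp _ => 1
  | var _ => 1
  | and φ ψ => φ.size + ψ.size + 1
  | or φ ψ => φ.size + ψ.size + 1
  | AX φ => φ.size + 1
  | EX φ => φ.size + 1
  | know _ φ => φ.size + 1
  | poss _ φ => φ.size + 1
  | mu _ φ => φ.size + 1
  | nu _ φ => φ.size + 1

/-- The tree semantics with every fixpoint replaced by the `N`-th stage of its iteration. -/
def approx [DecidableEq V] (M : MAS Q Ag P) (N : ℕ) :
    Formula Ag P V → (V → Set M.Node) → Set M.Node
  | prop p => fun _ => {x | p ∈ M.label x.state}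
  | negProp p => fun _ => {x | p ∉ M.label x.state}
  | var Z => fun ρ => ρ Z
  | and φ ψ => fun ρ => approx M N φ ρ ∩ approx M N ψ ρ
  | or φ ψ => fun ρ => approx M N φ ρ ∪ approx M N ψ ρ
  | AX φ => fun ρ => {x | ∀ y, M.Succ x y → y ∈ approx M N φ ρ}
  | EX φ => fun ρ => {x | ∃ y, M.Succ x y ∧ y ∈ approx M N φ ρ}
  | know a φ => fun ρ => {x | ∀ y, M.Indist a x y → y ∈ approx M N φ ρ}
  | poss a φ => fun ρ => {x | ∃ y, M.Indist a x y ∧ y ∈ approx M N φ ρ}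
  | mu Z φ => fun ρ => (fun S => approx M N φ (Function.update ρ Z S))^[N] ∅
  | nu Z φ => fun ρ => (fun S => approx M N φ (Function.update ρ Z S))^[N] Set.univ

variable {M : MAS Q Ag P} {N : ℕ}

/-- The colouring `c` has a stable refinement with property `p` whose number of colours is at most
the `i`-fold `growth` of the number of colours of `c`, provided that this bound does not exceed
`N`. -/
def Attainable (N i : ℕ) {α : Type} (c : M.Node → α)
    (p : ∀ β : Type, (M.Node → β) → Prop) : Prop :=
  growth^[i] (Nat.card α) ≤ N → ∃ (β : Type) (_ : Finite β) (d : M.Node → β),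
    Stable d ∧ Finer d c ∧ Nat.card β ≤ growth^[i] (Nat.card α) ∧ p β d

theorem Attainable.pure {α : Type} [Finite α] {c : M.Node → α}
    {p : ∀ β : Type, (M.Node → β) → Prop} (hc : Stable c) (hp : p α c) : Attainable N 0 c p :=
  fun _ => ⟨α, ‹_›, c, hc, fun _ _ h => h, le_rfl, hp⟩

theorem Attainable.bind {α : Type} {c : M.Node → α} {p q : ∀ β : Type, (M.Node → β) → Prop}
    {i j k : ℕ} (h : Attainable N i c p) (hk : i + j ≤ k)
    (hq : ∀ (β : Type) [Finite β] (d : M.Node → β), Stable d → Nat.card β ≤ N → p β d →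
      Attainable N j d q) : Attainable N k c q := by
  intro hN
  have hij : growth^[j] (growth^[i] (Nat.card α)) ≤ growth^[k] (Nat.card α) := by
    rw [← Function.iterate_add_apply]
    exact growth_iterate_le (by omega) le_rfl
  have hi := (growth_iterate_le (by omega : i ≤ k) (le_refl (Nat.card α))).trans hN
  obtain ⟨β, _, d, hd, hdc, hcard, hp⟩ := h hi
  have hj := (growth_iterate_le (le_refl j) hcard).trans hij
  obtain ⟨γ, _, e, he, hed, hcard', hq⟩ := hq β d hd (hcard.trans hi) hp (hj.trans hN)
  exact ⟨γ, ‹_›, e, he, hed.trans hdc, hcard'.trans hj, hq⟩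

theorem Attainable.finer {N i : ℕ} {α : Type} {c : M.Node → α}
    {p : ∀ β : Type, (M.Node → β) → Prop} (h : Attainable N i c p) :
    Attainable N i c fun β d => Finer d c ∧ p β d := fun hN =>
  let ⟨β, hβ, d, hd, hdc, hcard, hp⟩ := h hN
  ⟨β, hβ, d, hd, hdc, hcard, hdc, hp⟩

theorem attainable_refine {α : Type} [Finite α] {c : M.Node → α} (hc : Stable c) (a : Ag)
    {p : ∀ β : Type, (M.Node → β) → Prop} (hp : p _ (refine c a)) : Attainable N 1 c p :=
  fun _ => ⟨α × Set α, inferInstance, refine c a, hc.refine a, finer_refine c a,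
    (card_prod_set α).le, hp⟩

theorem NonClosedOp.not_closed {φ : Formula Ag P V} {a : Ag} (h : NonClosedOp φ a) :
    ¬ φ.Closed := by
  cases h <;> assumption

theorem NonMixing.of_child {φ ψ : Formula Ag P V} (h : φ.NonMixing M) (hψ : ψ ∈ φ.children) :
    ψ.NonMixing M :=
  fun χ hχ => h χ (Relation.ReflTransGen.head hψ hχ)

variable [DecidableEq V]

theorem update_congr {α : Type} {s : Set V} {Z : V} {ρ σ : V → α}
    (h : ∀ Y ∈ s \ {Z}, ρ Y = σ Y) (S : α) :
    ∀ Y ∈ s, Function.update ρ Z S Y = Function.update σ Z S Y := by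
  intro Y hY
  by_cases hYZ : Y = Z
  · subst hYZ; simp
  · simpa [hYZ] using h Y ⟨hY, hYZ⟩

theorem sem_congr (φ : Formula Ag P V) {ρ σ : V → Set M.Node}
    (h : ∀ Z ∈ φ.freeVars, ρ Z = σ Z) : φ.sem M ρ = φ.sem M σ := by
  induction φ generalizing ρ σ with
  | prop p => rfl
  | negProp p => rfl
  | var Z => exact h Z rfl
  | and φ ψ ih₁ ih₂ =>
    change sem M φ ρ ∩ sem M ψ ρ = sem M φ σ ∩ sem M ψ σ
    rw [ih₁ fun Z hZ => h Z (Or.inl hZ), ih₂ fun Z hZ => h Z (Or.inr hZ)]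
  | or φ ψ ih₁ ih₂ =>
    change sem M φ ρ ∪ sem M ψ ρ = sem M φ σ ∪ sem M ψ σ
    rw [ih₁ fun Z hZ => h Z (Or.inl hZ), ih₂ fun Z hZ => h Z (Or.inr hZ)]
  | AX φ ih =>
    change {x | ∀ y, M.Succ x y → y ∈ sem M φ ρ} = _
    rw [ih h]; rfl
  | EX φ ih =>
    change {x | ∃ y, M.Succ x y ∧ y ∈ sem M φ ρ} = _
    rw [ih h]; rfl
  | know a φ ih =>
    change {x | ∀ y, M.Indist a x y → y ∈ sem M φ ρ} = _
    rw [ih h]; rfl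
  | poss a φ ih =>
    change {x | ∃ y, M.Indist a x y ∧ y ∈ sem M φ ρ} = _
    rw [ih h]; rfl
  | mu Z φ ih =>
    exact congrArg OrderHom.lfp (OrderHom.ext _ _ (funext fun S => ih (update_congr h S)))
  | nu Z φ ih =>
    exact congrArg OrderHom.gfp (OrderHom.ext _ _ (funext fun S => ih (update_congr h S)))

theorem approx_congr (φ : Formula Ag P V) {ρ σ : V → Set M.Node}
    (h : ∀ Z ∈ φ.freeVars, ρ Z = σ Z) : φ.approx M N ρ = φ.approx M N σ := by
  induction φ generalizing ρ σ with
  | prop p => rfl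
  | negProp p => rfl
  | var Z => exact h Z rfl
  | and φ ψ ih₁ ih₂ =>
    simp only [approx]
    rw [ih₁ fun Z hZ => h Z (Or.inl hZ), ih₂ fun Z hZ => h Z (Or.inr hZ)]
  | or φ ψ ih₁ ih₂ =>
    simp only [approx]
    rw [ih₁ fun Z hZ => h Z (Or.inl hZ), ih₂ fun Z hZ => h Z (Or.inr hZ)]
  | AX φ ih => simp only [approx]; rw [ih h]
  | EX φ ih => simp only [approx]; rw [ih h]
  | know a φ ih => simp only [approx]; rw [ih h]
  | poss a φ ih => simp only [approx]; rw [ih h]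
  | mu Z φ ih =>
    simp only [approx]
    rw [show (fun S => approx M N φ (Function.update ρ Z S)) = _ from
      funext fun S => ih (update_congr h S)]
  | nu Z φ ih =>
    simp only [approx]
    rw [show (fun S => approx M N φ (Function.update ρ Z S)) = _ from
      funext fun S => ih (update_congr h S)]

/-- The value of `φ` is invariant under the colouring `e`, and `N` iterations of every fixpoint
compute it, provided that the values of the variables are invariant under `e`. -/
def ApproxExact (M : MAS Q Ag P) (N : ℕ) (φ : Formula Ag P V) {α : Type} (e : M.Node → α) : Prop :=
  ∀ ρ : V → Set M.Node, (∀ Z, Invariant e (ρ Z)) →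
    Invariant e (φ.sem M ρ) ∧ φ.approx M N ρ = φ.sem M ρ

/-- The colouring `d` is fine enough for `φ`: every finer stable colouring with at most `N` colours
that respects the non-closed operators of `φ` is a finite bisimulation quotient of the tree in
which `φ` can be evaluated. -/
def FineEnough (M : MAS Q Ag P) (N : ℕ) (φ : Formula Ag P V) {α : Type} (d : M.Node → α) : Prop :=
  ∀ (γ : Type) [Finite γ] (e : M.Node → γ), Stable e → Finer e d → Nat.card γ ≤ N →
    (∀ a, NonClosedOp φ a → Respects e a) → ApproxExact M N φ e

theorem ApproxExact.of_closed {φ : Formula Ag P V} (hφ : φ.Closed) {α : Type}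
    {d : M.Node → α} (h : ApproxExact M N φ d) (ρ : V → Set M.Node) :
    Invariant d (φ.sem M ρ) ∧ φ.approx M N ρ = φ.sem M ρ := by
  have hfv : ∀ Z ∈ φ.freeVars, ρ Z = (fun _ => ∅ : V → Set M.Node) Z := by
    intro Z hZ
    rw [show φ.freeVars = ∅ from hφ] at hZ
    exact hZ.elim
  rw [sem_congr φ hfv, approx_congr φ hfv]
  exact h (fun _ => ∅) fun Z x y _ hx => hx

/-- The value of a closed formula does not depend on the values of the variables, so that a
colouring for which iteration is exact is fine enough. -/
theorem ApproxExact.fineEnough {φ : Formula Ag P V} (hφ : φ.Closed) {α : Type}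
    {d : M.Node → α} (h : ApproxExact M N φ d) : FineEnough M N φ d :=
  fun _ _ _ _ hed _ _ ρ _ => ⟨(h.of_closed hφ ρ).1.mono hed, (h.of_closed hφ ρ).2⟩

theorem FineEnough.approxExact {φ : Formula Ag P V} (hφ : φ.Closed) {α : Type} [Finite α]
    {d : M.Node → α} (hd : Stable d) (hN : Nat.card α ≤ N) (h : FineEnough M N φ d) :
    ApproxExact M N φ d :=
  h α d hd (fun _ _ h => h) hN fun _ ha => (ha.not_closed hφ).elim

theorem FineEnough.mono {φ : Formula Ag P V} {α β : Type} {e : M.Node → α} {d : M.Node → β}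
    (hed : Finer e d) (h : FineEnough M N φ d) : FineEnough M N φ e :=
  fun γ _ f hf hfe => h γ f hf (hfe.trans hed)

/-- The operators of an immediate subformula are operators of the formula, unless the formula
is closed while the subformula is not, which happens at fixpoint operators only. -/
theorem FineEnough.child {φ ψ : Formula Ag P V} {α : Type} {d : M.Node → α}
    (hψ : ψ ∈ φ.children) (hcl : φ.Closed → ψ.Closed) (h : FineEnough M N ψ d) {γ : Type}
    [Finite γ] {e : M.Node → γ} (he : Stable e) (hed : Finer e d) (hN : Nat.card γ ≤ N)
    (hr : ∀ a, NonClosedOp φ a → Respects e a) : ApproxExact M N ψ e :=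
  h γ e he hed hN fun a ha =>
    hr a (NonClosedOp.step φ ψ a (fun hφ => ha.not_closed (hcl hφ)) hψ ha)

theorem ApproxExact.and {φ ψ : Formula Ag P V} {γ : Type} {e : M.Node → γ}
    (h₁ : ApproxExact M N φ e) (h₂ : ApproxExact M N ψ e) : ApproxExact M N (φ.and ψ) e := by
  intro ρ hρ
  refine ⟨fun x y hxy hx => ⟨(h₁ ρ hρ).1 hxy hx.1, (h₂ ρ hρ).1 hxy hx.2⟩, ?_⟩
  simp only [approx]
  rw [(h₁ ρ hρ).2, (h₂ ρ hρ).2]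
  rfl

theorem ApproxExact.or {φ ψ : Formula Ag P V} {γ : Type} {e : M.Node → γ}
    (h₁ : ApproxExact M N φ e) (h₂ : ApproxExact M N ψ e) : ApproxExact M N (φ.or ψ) e := by
  intro ρ hρ
  refine ⟨fun x y hxy hx => hx.imp ((h₁ ρ hρ).1 hxy) ((h₂ ρ hρ).1 hxy), ?_⟩
  simp only [approx]
  rw [(h₁ ρ hρ).2, (h₂ ρ hρ).2]
  rfl

theorem ApproxExact.AX {φ : Formula Ag P V} {γ : Type} {e : M.Node → γ} (he : Stable e)
    (h : ApproxExact M N φ e) : ApproxExact M N φ.AX e := by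
  intro ρ hρ
  refine ⟨fun x y hxy hx y' hy' => ?_, ?_⟩
  · obtain ⟨x', hx', hxy'⟩ := he.succ hxy.symm hy'
    exact (h ρ hρ).1 hxy'.symm (hx x' hx')
  · simp only [approx]
    rw [(h ρ hρ).2]
    rfl

theorem ApproxExact.EX {φ : Formula Ag P V} {γ : Type} {e : M.Node → γ} (he : Stable e)
    (h : ApproxExact M N φ e) : ApproxExact M N φ.EX e := by
  intro ρ hρ
  refine ⟨?_, ?_⟩
  · rintro x y hxy ⟨x', hx', hm⟩
    obtain ⟨y', hy', hxy'⟩ := he.succ hxy hx'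
    exact ⟨y', hy', (h ρ hρ).1 hxy' hm⟩
  · simp only [approx]
    rw [(h ρ hρ).2]
    rfl

theorem ApproxExact.know {φ : Formula Ag P V} {γ δ : Type} {e : M.Node → γ} {d : M.Node → δ}
    {a : Ag}
    (he : ∀ ⦃x y x' : M.Node⦄, e x = e y → M.Indist a x x' →
      ∃ y', M.Indist a y y' ∧ d x' = d y')
    (h : ∀ ρ : V → Set M.Node, (∀ Z, Invariant e (ρ Z)) →
      Invariant d (φ.sem M ρ) ∧ φ.approx M N ρ = φ.sem M ρ) :
    ApproxExact M N (φ.know a) e := by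
  intro ρ hρ
  refine ⟨fun x y hxy hx y' hy' => ?_, ?_⟩
  · obtain ⟨x', hx', hxy'⟩ := he hxy.symm hy'
    exact (h ρ hρ).1 hxy'.symm (hx x' hx')
  · simp only [approx]
    rw [(h ρ hρ).2]
    rfl

theorem ApproxExact.poss {φ : Formula Ag P V} {γ δ : Type} {e : M.Node → γ} {d : M.Node → δ}
    {a : Ag}
    (he : ∀ ⦃x y x' : M.Node⦄, e x = e y → M.Indist a x x' →
      ∃ y', M.Indist a y y' ∧ d x' = d y')
    (h : ∀ ρ : V → Set M.Node, (∀ Z, Invariant e (ρ Z)) →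
      Invariant d (φ.sem M ρ) ∧ φ.approx M N ρ = φ.sem M ρ) :
    ApproxExact M N (φ.poss a) e := by
  intro ρ hρ
  refine ⟨?_, ?_⟩
  · rintro x y hxy ⟨x', hx', hm⟩
    obtain ⟨y', hy', hxy'⟩ := he hxy hx'
    exact ⟨y', hy', (h ρ hρ).1 hxy' hm⟩
  · simp only [approx]
    rw [(h ρ hρ).2]
    rfl

theorem invariant_update {γ : Type} {e : M.Node → γ} {ρ : V → Set M.Node}
    (hρ : ∀ Z, Invariant e (ρ Z)) {S : Set M.Node} (hS : Invariant e S) (Z Y : V) :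
    Invariant e (Function.update ρ Z S Y) := by
  by_cases h : Y = Z
  · subst h; simpa using hS
  · simpa [h] using hρ Y

/-- On invariant sets the bodies of the exact and the approximate semantics agree, and so do
their iterates. -/
theorem ApproxExact.iterate_eq {φ : Formula Ag P V} {γ : Type} {e : M.Node → γ}
    (h : ApproxExact M N φ e) {ρ : V → Set M.Node} (hρ : ∀ Z, Invariant e (ρ Z)) (Z : V)
    {S : Set M.Node} (hS : Invariant e S) (i : ℕ) :
    (fun S => φ.approx M N (Function.update ρ Z S))^[i] S =
        (fun S => φ.sem M (Function.update ρ Z S))^[i] S ∧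
      Invariant e ((fun S => φ.sem M (Function.update ρ Z S))^[i] S) := by
  induction i with
  | zero => exact ⟨rfl, hS⟩
  | succ i ih =>
    rw [Function.iterate_succ_apply', Function.iterate_succ_apply', ih.1]
    have := h _ (invariant_update hρ ih.2 Z)
    exact ⟨this.2, this.1⟩

theorem ApproxExact.mu {φ : Formula Ag P V} {γ : Type} [Finite γ] {e : M.Node → γ}
    (hN : Nat.card γ ≤ N) (h : ApproxExact M N φ e) (Z : V) : ApproxExact M N (φ.mu Z) e := by
  intro ρ hρ
  have := lfp_eq_iterate (c := e) ⟨fun S => sem M φ (Function.update ρ Z S), fun _ _ h =>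
    (sem M φ).monotone (update_mono le_rfl h Z)⟩
    (fun S hS => (h _ (invariant_update hρ hS Z)).1) hN
  exact ⟨this.2, (h.iterate_eq hρ Z (fun _ _ _ hx => hx) N).1.trans this.1⟩

theorem ApproxExact.nu {φ : Formula Ag P V} {γ : Type} [Finite γ] {e : M.Node → γ}
    (hN : Nat.card γ ≤ N) (h : ApproxExact M N φ e) (Z : V) : ApproxExact M N (φ.nu Z) e := by
  intro ρ hρ
  have := gfp_eq_iterate (c := e) ⟨fun S => sem M φ (Function.update ρ Z S), fun _ _ h =>
    (sem M φ).monotone (update_mono le_rfl h Z)⟩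
    (fun S hS => (h _ (invariant_update hρ hS Z)).1) hN
  exact ⟨this.2, (h.iterate_eq hρ Z (fun _ _ _ hx => hx) N).1.trans this.1⟩

/-- Refining a colouring that is fine enough for the body by all agents with a non-closed operator
in the body makes iteration exact for the body; this is where the non-mixing condition enters. -/
theorem FineEnough.attainable_approxExact [Fintype Ag] {φ : Formula Ag P V} (hmix : φ.NonMixing M)
    {α : Type} [Finite α] {c : M.Node → α} (hc : Stable c) (h : FineEnough M N φ c) :
    Attainable N (Fintype.card Ag) c fun _ d => ApproxExact M N φ d := by
  classical
  intro hN
  obtain ⟨β, _, d, hd, hdc, hcard, hr⟩ := MAS.exists_respects hc _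
    (Finset.univ.filter fun a => NonClosedOp φ a) rfl fun a ha b hb =>
      hmix φ Relation.ReflTransGen.refl a b (Finset.mem_filter.1 ha).2 (Finset.mem_filter.1 hb).2
  have hcard' := hcard.trans (growth_iterate_le (Finset.card_le_univ _) le_rfl)
  exact ⟨β, ‹_›, d, hd, hdc, hcard', h β d hd hdc (hcard'.trans hN) fun a ha =>
    hr a (Finset.mem_filter.2 ⟨Finset.mem_univ a, ha⟩)⟩

/-- Every stable colouring has a refinement that is fine enough for a given non-mixing formula and
whose number of colours is bounded in terms of the size of the formula. -/
theorem attainable_fineEnough [Fintype Ag] (φ : Formula Ag P V) (hmix : φ.NonMixing M)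
    {α : Type} [Finite α] {c : M.Node → α} (hc : Stable c) :
    Attainable N ((Fintype.card Ag + 1) * φ.size) c fun _ d => FineEnough M N φ d := by
  -- Every node of the syntax tree leaves room for one refinement by each agent.
  have hone : ∀ s, ∀ i ≤ Fintype.card Ag + 1,
      (Fintype.card Ag + 1) * s + i ≤ (Fintype.card Ag + 1) * (s + 1) := fun s i hi => by
    rw [mul_add, mul_one]; omega
  have htwo : ∀ s t, (Fintype.card Ag + 1) * s + (Fintype.card Ag + 1) * t ≤
      (Fintype.card Ag + 1) * (s + t + 1) := fun s t => by
    rw [← mul_add]; exact Nat.mul_le_mul_left _ (by omega)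
  induction φ generalizing α with
  | prop p =>
    refine Attainable.bind (.pure (p := fun _ _ => True) hc trivial) (Nat.zero_le _)
      fun β _ d hd _ _ => .pure hd fun γ _ e he _ _ _ ρ hρ => ⟨?_, rfl⟩
    intro x y hxy (hx : p ∈ M.label x.state)
    rwa [he.state hxy] at hx
  | negProp p =>
    refine Attainable.bind (.pure (p := fun _ _ => True) hc trivial) (Nat.zero_le _)
      fun β _ d hd _ _ => .pure hd fun γ _ e he _ _ _ ρ hρ => ⟨?_, rfl⟩
    intro x y hxy (hx : p ∉ M.label x.state)
    rwa [he.state hxy] at hx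
  | var Z =>
    exact Attainable.bind (.pure (p := fun _ _ => True) hc trivial) (Nat.zero_le _)
      fun β _ d hd _ _ => .pure hd fun γ _ e _ _ _ _ ρ hρ => ⟨hρ Z, rfl⟩
  | and φ ψ ih₁ ih₂ =>
    refine (ih₁ (hmix.of_child (by simp [children])) hc).bind (htwo _ _) fun β _ d hd _ hφ =>
      (ih₂ (hmix.of_child (by simp [children])) hd).finer.bind le_rfl fun γ _ e he _ hψ =>
        .pure he fun δ _ f hf hfe hN hr => ?_
    refine .and ((hφ.mono hψ.1).child (by simp [children]) (fun h => ?_) hf hfe hN hr)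
      (hψ.2.child (by simp [children]) (fun h => ?_) hf hfe hN hr)
    · exact (Set.union_empty_iff.1 h).1
    · exact (Set.union_empty_iff.1 h).2
  | or φ ψ ih₁ ih₂ =>
    refine (ih₁ (hmix.of_child (by simp [children])) hc).bind (htwo _ _) fun β _ d hd _ hφ =>
      (ih₂ (hmix.of_child (by simp [children])) hd).finer.bind le_rfl fun γ _ e he _ hψ =>
        .pure he fun δ _ f hf hfe hN hr => ?_
    refine .or ((hφ.mono hψ.1).child (by simp [children]) (fun h => ?_) hf hfe hN hr)
      (hψ.2.child (by simp [children]) (fun h => ?_) hf hfe hN hr)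
    · exact (Set.union_empty_iff.1 h).1
    · exact (Set.union_empty_iff.1 h).2
  | AX φ ih =>
    exact (ih (hmix.of_child (by simp [children])) hc).bind (hone _ 0 (Nat.zero_le _))
      fun β _ d hd _ hφ => .pure hd fun γ _ e he hed hN hr =>
        .AX he (hφ.child (ψ := φ) (φ := .AX φ) (by simp [children]) (fun h => h) he hed hN hr)
  | EX φ ih =>
    exact (ih (hmix.of_child (by simp [children])) hc).bind (hone _ 0 (Nat.zero_le _))
      fun β _ d hd _ hφ => .pure hd fun γ _ e he hed hN hr =>
        .EX he (hφ.child (ψ := φ) (φ := .EX φ) (by simp [children]) (fun h => h) he hed hN hr)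
  | know a φ ih =>
    have hφ := ih (hmix.of_child (by simp [children])) hc
    -- If the formula is closed, so is its body, and one refinement by `a` is enough; otherwise `a`
    -- is among the agents that the finer colouring respects.
    by_cases hcl : (know a φ).Closed
    · have hcl' : φ.Closed := hcl
      refine hφ.bind (hone _ 1 (by omega)) fun β _ d hd hβ hφ => attainable_refine hd a
        (ApproxExact.fineEnough hcl (.know (d := d) (fun x y x' h hx => ?_)
          fun ρ _ => (hφ.approxExact hcl' hd hβ).of_closed hcl' ρ))
      obtain ⟨y', hy', h'⟩ := respects_refine (Or.inl rfl) le_rfl h hx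
      exact ⟨y', hy', finer_refine d a h'⟩
    · exact hφ.bind (hone _ 0 (Nat.zero_le _)) fun β _ d hd _ hφ => .pure hd
        fun γ _ e he hed hN hr => .know (hr a (.know a φ hcl))
          (hφ.child (ψ := φ) (φ := .know a φ) (by simp [children]) (fun h => h) he hed hN hr)
  | poss a φ ih =>
    have hφ := ih (hmix.of_child (by simp [children])) hc
    -- If the formula is closed, so is its body, and one refinement by `a` is enough; otherwise `a`
    -- is among the agents that the finer colouring respects.
    by_cases hcl : (poss a φ).Closed
    · have hcl' : φ.Closed := hcl
      refine hφ.bind (hone _ 1 (by omega)) fun β _ d hd hβ hφ => attainable_refine hd a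
        (ApproxExact.fineEnough hcl (.poss (d := d) (fun x y x' h hx => ?_)
          fun ρ _ => (hφ.approxExact hcl' hd hβ).of_closed hcl' ρ))
      obtain ⟨y', hy', h'⟩ := respects_refine (Or.inl rfl) le_rfl h hx
      exact ⟨y', hy', finer_refine d a h'⟩
    · exact hφ.bind (hone _ 0 (Nat.zero_le _)) fun β _ d hd _ hφ => .pure hd
        fun γ _ e he hed hN hr => .poss (hr a (.poss a φ hcl))
          (hφ.child (ψ := φ) (φ := .poss a φ) (by simp [children]) (fun h => h) he hed hN hr)
  | mu Z φ ih =>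
    have hm : φ.NonMixing M := hmix.of_child (by simp [children])
    have hφ := ih hm hc
    -- Only at a closed fixpoint formula may the body have non-closed operators that the formula
    -- itself lacks.
    by_cases hcl : (mu Z φ).Closed
    · exact hφ.bind (hone _ _ (Nat.le_succ _)) fun β _ d hd _ hφ =>
        (hφ.attainable_approxExact hm hd).bind (j := 0) le_rfl fun γ _ e he hγ hφ =>
          .pure he ((hφ.mu hγ Z).fineEnough hcl)
    · exact hφ.bind (hone _ 0 (Nat.zero_le _)) fun β _ d hd _ hφ => .pure hd
        fun γ _ e he hed hN hr => .mu hN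
          (hφ.child (by simp [children]) (fun h => (hcl h).elim) he hed hN hr) Z
  | nu Z φ ih =>
    have hm : φ.NonMixing M := hmix.of_child (by simp [children])
    have hφ := ih hm hc
    -- Only at a closed fixpoint formula may the body have non-closed operators that the formula
    -- itself lacks.
    by_cases hcl : (nu Z φ).Closed
    · exact hφ.bind (hone _ _ (Nat.le_succ _)) fun β _ d hd _ hφ =>
        (hφ.attainable_approxExact hm hd).bind (j := 0) le_rfl fun γ _ e he hγ hφ =>
          .pure he ((hφ.nu hγ Z).fineEnough hcl)
    · exact hφ.bind (hone _ 0 (Nat.zero_le _)) fun β _ d hd _ hφ => .pure hd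
        fun γ _ e he hed hN hr => .nu hN
          (hφ.child (by simp [children]) (fun h => (hcl h).elim) he hed hN hr) Z

/-- For closed non-mixing formulas over a finite system, iterating all fixpoints as often as the
bound on the number of colours says computes the tree semantics. -/
theorem approx_eq_sem [Fintype Ag] [Finite Q] {φ : Formula Ag P V} (hcl : φ.Closed)
    (hmix : φ.NonMixing M) (ρ : V → Set M.Node) :
    φ.approx M (growth^[(Fintype.card Ag + 1) * φ.size] (Nat.card Q)) ρ = φ.sem M ρ := by
  obtain ⟨β, _, d, hd, -, hcard, h⟩ := attainable_fineEnough φ hmix (stable_state M) le_rfl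
  exact ((h.approxExact hcl hd hcard).of_closed hcl ρ).2

end Formula
/-! ### Unrolling the fixpoints of a formula -/

namespace Formula

section Unroll

variable {Q Ag P V : Type} [DecidableEq V] {M : MAS Q Ag P} {N : ℕ}

/-- Replace all occurrences of the variable `Z` by `χ`, also those in the scope of a fixpoint
operator for `Z`. -/
def subst (Z : V) (χ : Formula Ag P V) : Formula Ag P V → Formula Ag P V
  | prop p => prop p
  | negProp p => negProp p
  | var Y => if Y = Z then χ else var Y
  | and φ ψ => and (subst Z χ φ) (subst Z χ ψ)
  | or φ ψ => or (subst Z χ φ) (subst Z χ ψ)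
  | AX φ => AX (subst Z χ φ)
  | EX φ => EX (subst Z χ φ)
  | know a φ => know a (subst Z χ φ)
  | poss a φ => poss a (subst Z χ φ)
  | mu Y φ => mu Y (subst Z χ φ)
  | nu Y φ => nu Y (subst Z χ φ)

/-- Replace every fixpoint by the `N`-th stage of its iteration. The fixpoint operators in the
result stand for their `0`-th stages, the constants `false` and `true`; what is below them is
irrelevant. -/
def unroll (N : ℕ) : Formula Ag P V → Formula Ag P V
  | prop p => prop p
  | negProp p => negProp p
  | var Y => var Y
  | and φ ψ => and (unroll N φ) (unroll N ψ)
  | or φ ψ => or (unroll N φ) (unroll N ψ)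
  | AX φ => AX (unroll N φ)
  | EX φ => EX (unroll N φ)
  | know a φ => know a (unroll N φ)
  | poss a φ => poss a (unroll N φ)
  | mu Z φ => (fun χ => subst Z χ (unroll N φ))^[N] (mu Z (var Z))
  | nu Z φ => (fun χ => subst Z χ (unroll N φ))^[N] (nu Z (var Z))

theorem approx_zero_subst (Z : V) (χ φ : Formula Ag P V) (ρ : V → Set M.Node) :
    (subst Z χ φ).approx M 0 ρ = φ.approx M 0 (Function.update ρ Z (χ.approx M 0 ρ)) := by
  induction φ with
  | var Y =>
    by_cases h : Y = Z
    · subst h; simp [subst, approx]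
    · simp [subst, approx, h]
  | _ => simp_all [subst, approx]

theorem approx_zero_iterate_subst {Z : V} {φ χ : Formula Ag P V} {ρ : V → Set M.Node} (i : ℕ) :
    ((fun χ => subst Z χ φ)^[i] χ).approx M 0 ρ =
      (fun S => φ.approx M 0 (Function.update ρ Z S))^[i] (χ.approx M 0 ρ) := by
  induction i with
  | zero => rfl
  | succ i ih => rw [Function.iterate_succ_apply', Function.iterate_succ_apply',
      approx_zero_subst, ih]

theorem approx_zero_unroll (φ : Formula Ag P V) (ρ : V → Set M.Node) :
    (φ.unroll N).approx M 0 ρ = φ.approx M N ρ := by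
  induction φ generalizing ρ with
  | mu Z φ ih => simp [unroll, approx_zero_iterate_subst, ih, approx]
  | nu Z φ ih => simp [unroll, approx_zero_iterate_subst, ih, approx]
  | _ => simp_all [unroll, approx]

end Unroll

variable {k m v : ℕ}

theorem length_encode (φ : Formula (Fin k) (Fin m) (Fin v)) : φ.encode.length = φ.size := by
  induction φ <;> simp_all [encode, size]

end Formula

/-- Substitution of a coded formula `c` for the variable with number `Z` in the coded formula `l`
without binding. -/
def substCode (Z : ℕ) (l c : List (ℕ × ℕ)) : List (ℕ × ℕ) :=
  l.flatMap fun t => if t = (2, Z) then c else [t]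

/-- Reading a formula in Polish notation from the right with a stack of coded formulas: the top
entries are the unrolled arguments of the symbol `t`, and are replaced by the unrolled formula. -/
def unrollStep (N : ℕ) (t : ℕ × ℕ) (s : List (List (ℕ × ℕ))) : List (List (ℕ × ℕ)) :=
  if t.1 ≤ 2 then [t] :: s
  else if t.1 ≤ 4 then (t :: (s.headI ++ s.tail.headI)) :: s.tail.tail
  else if t.1 ≤ 8 then (t :: s.headI) :: s.tail
  else (substCode t.2 s.headI)^[N] [t, (2, t.2)] :: s.tail

namespace Formula

variable {k m v : ℕ}

theorem encode_subst (Z : Fin v) (χ φ : Formula (Fin k) (Fin m) (Fin v)) :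
    (subst Z χ φ).encode = substCode Z φ.encode χ.encode := by
  induction φ with
  | var Y =>
    by_cases h : Y = Z
    · subst h; simp [subst, encode, substCode]
    · simp [subst, encode, substCode, h, Fin.val_inj]
  | _ => simp_all [subst, encode, substCode]

theorem encode_iterate_subst (Z : Fin v) (χ φ : Formula (Fin k) (Fin m) (Fin v)) (i : ℕ) :
    ((fun χ => subst Z χ φ)^[i] χ).encode = (substCode Z φ.encode)^[i] χ.encode := by
  induction i with
  | zero => rfl
  | succ i ih => rw [Function.iterate_succ_apply', Function.iterate_succ_apply', encode_subst, ih]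

theorem foldr_unrollStep (N : ℕ) (φ : Formula (Fin k) (Fin m) (Fin v))
    (s : List (List (ℕ × ℕ))) :
    φ.encode.foldr (unrollStep N) s = (φ.unroll N).encode :: s := by
  induction φ generalizing s with
  | mu Z φ ih => simp [encode, unroll, unrollStep, ih, encode_iterate_subst]
  | nu Z φ ih => simp [encode, unroll, unrollStep, ih, encode_iterate_subst]
  | _ => simp_all [encode, unroll, unrollStep]

end Formula

/-! ### Evaluation in a truncated tree -/

/-- The codes of finite systems. -/
abbrev SystemCode : Type :=
  (ℕ × ℕ × ℕ × ℕ) × List (List Bool) × List (List Bool) × List (List Bool)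

/-- An entry of a Boolean matrix, `false` outside the matrix. -/
def entry (A : List (List Bool)) (i j : ℕ) : Bool := (A.getD i []).getD j false

theorem entry_matrixOf {m n : ℕ} (R : Fin m → Fin n → Prop) (i : Fin m) (j : Fin n) :
    entry (matrixOf R) i j = true ↔ R i j := by
  simp [entry, matrixOf, List.getD_eq_getElem?_getD]

/-- The state at a node. Nodes are coded by reversed words, so that the last state comes first. -/
def lastState (S : SystemCode) (w : List ℕ) : ℕ := w.head?.getD S.1.2.2.2

/-- The coded nodes of length at most `d`. -/
def truncatedTree (S : SystemCode) (d : ℕ) : List (List ℕ) :=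
  (fun U => [] :: U.flatMap fun w =>
    ((List.range S.1.1).filter fun q => entry S.2.1 (lastState S w) q).map fun q => q :: w)^[d]
      [[]]

/-- What the agent with number `a` observes in a state. -/
def view (S : SystemCode) (a q : ℕ) : List Bool :=
  (List.range S.1.2.2.1).map fun p => entry S.2.2.2 q p && entry S.2.2.1 a p

/-- The value of the operation with the code `t` (in the sense of `Formula.encode`), applied to
values `A` and `B`, in the list of nodes `U`. Variables get the value `∅`; fixpoint operators are
constants. The values of `AX` and `EX` at the leaves of the truncated tree are meaningless. -/
def applyOp (S : SystemCode) (U : List (List ℕ)) (t : ℕ × ℕ) (A B : List (List ℕ)) :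
    List (List ℕ) :=
  if t.1 = 0 then U.filter fun w => entry S.2.2.2 (lastState S w) t.2
  else if t.1 = 1 then U.filter fun w => !entry S.2.2.2 (lastState S w) t.2
  else if t.1 = 3 then A.filter fun w => B.contains w
  else if t.1 = 4 then A ++ B
  else if t.1 = 5 then U.filter fun w =>
    (List.range S.1.1).all fun q => !U.contains (q :: w) || A.contains (q :: w)
  else if t.1 = 6 then U.filter fun w =>
    (List.range S.1.1).any fun q => U.contains (q :: w) && A.contains (q :: w)
  else if t.1 = 7 then U.filter fun w =>
    U.all fun u => !(w.map (view S t.2) == u.map (view S t.2)) || A.contains u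
  else if t.1 = 8 then U.filter fun w =>
    U.any fun u => (w.map (view S t.2) == u.map (view S t.2)) && A.contains u
  else if t.1 = 10 then U
  else []

/-- Evaluation of a formula in Polish notation, read from the right, with a stack of values. -/
def evalStep (S : SystemCode) (U : List (List ℕ)) (t : ℕ × ℕ) (s : List (List (List ℕ))) :
    List (List (List ℕ)) :=
  applyOp S U t s.headI s.tail.headI ::
    if t.1 ≤ 2 then s else if t.1 ≤ 4 then s.tail.tail else s.tail

section Correctness

variable {n k m v : ℕ} {M : MAS (Fin n) (Fin k) (Fin m)}

namespace MAS

/-- The code of a node: the reversed word of the numbers of its states. -/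
def Node.code (x : M.Node) : List ℕ := (x.1.map Fin.val).reverse

theorem Node.code_of_append {x y : M.Node} {q : Fin n} (h : y.1 = x.1 ++ [q]) :
    y.code = (q : ℕ) :: x.code := by
  simp [Node.code, h]

theorem Node.length_code (x : M.Node) : x.code.length = x.1.length := by
  simp [Node.code]

theorem lastState_code (x : M.Node) : lastState M.encode x.code = (x.state : ℕ) := by
  obtain ⟨l, hl⟩ := x
  rcases List.eq_nil_or_concat l with rfl | ⟨l, q, rfl⟩
  · simp [lastState, Node.code, Node.state, MAS.encode]
  · simp [lastState, Node.code, Node.state]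

theorem mem_truncatedTree {d : ℕ} {w : List ℕ} :
    w ∈ truncatedTree M.encode d ↔ ∃ x : M.Node, x.1.length ≤ d ∧ x.code = w := by
  induction d generalizing w with
  | zero =>
    simp only [truncatedTree, Function.iterate_zero, id, List.mem_singleton]
    constructor
    · rintro rfl
      exact ⟨M.root, le_rfl, rfl⟩
    · rintro ⟨x, hx, rfl⟩
      exact List.eq_nil_of_length_eq_zero (by rw [Node.length_code]; omega)
  | succ d ih =>
    rw [truncatedTree, Function.iterate_succ_apply', ← truncatedTree]
    simp only [List.mem_cons, List.mem_flatMap, List.mem_map, List.mem_filter, List.mem_range]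
    constructor
    · rintro (rfl | ⟨w, hw, q, ⟨hq, he⟩, rfl⟩)
      · exact ⟨M.root, Nat.zero_le _, rfl⟩
      · obtain ⟨x, hx, rfl⟩ := ih.1 hw
        rw [lastState_code] at he
        have := (isChain_append_iff x ⟨q, hq⟩).2 ((entry_matrixOf M.trans x.state ⟨q, hq⟩).1 he)
        refine ⟨⟨x.1 ++ [⟨q, hq⟩], this⟩, by simpa using hx,
          Node.code_of_append (q := ⟨q, hq⟩) rfl⟩
    · rintro ⟨⟨l, hl⟩, hx, rfl⟩
      rcases List.eq_nil_or_concat l with rfl | ⟨l, q, rfl⟩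
      · exact Or.inl rfl
      · right
        rw [List.concat_eq_append] at hl
        let y : M.Node := ⟨l, by
          rw [← List.cons_append] at hl
          exact hl.left_of_append⟩
        refine ⟨y.code, ih.2 ⟨y, by simpa using hx, rfl⟩, q, ⟨q.2, ?_⟩, ?_⟩
        · rw [lastState_code]
          exact (entry_matrixOf M.trans y.state q).2 ((isChain_append_iff y q).1 hl)
        · exact (Node.code_of_append (x := y) (by simp [y])).symm

theorem view_eq_iff {a : Fin k} {q r : Fin n} :
    view M.encode a q = view M.encode a r ↔ M.label q ∩ M.obs a = M.label r ∩ M.obs a := by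
  have key : ∀ (q : Fin n) (p : Fin m),
      (entry M.encode.2.2.2 q p && entry M.encode.2.2.1 a p) = true ↔ p ∈ M.label q ∩ M.obs a := by
    intro q p
    rw [Bool.and_eq_true]
    exact and_congr (entry_matrixOf (fun q p => p ∈ M.label q) q p)
      (entry_matrixOf (fun a p => p ∈ M.obs a) a p)
  simp only [view, List.map_inj_left, List.mem_range, Set.ext_iff, ← key, Bool.coe_iff_coe]
  exact ⟨fun h p => h p p.2, fun h p hp => h ⟨p, hp⟩⟩

theorem map_view_code_eq_iff {a : Fin k} {x y : M.Node} :
    x.code.map (view M.encode a) = y.code.map (view M.encode a) ↔ M.Indist a x y := by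
  have key : ∀ l l' : List (Fin n), l.map (fun q : Fin n => view M.encode a q) =
      l'.map (fun q : Fin n => view M.encode a q) ↔
      l.map (fun q => M.label q ∩ M.obs a) = l'.map (fun q => M.label q ∩ M.obs a) := by
    intro l
    induction l with
    | nil => intro l'; cases l' <;> simp
    | cons q l ih =>
      intro l'
      cases l' with
      | nil => simp
      | cons r l' => simp [ih, view_eq_iff]
  rw [Node.code, Node.code, List.map_reverse, List.map_reverse, List.reverse_inj, List.map_map,
    List.map_map]
  simp only [Indist, observations, List.map_cons, List.cons.injEq, true_and]
  exact key x.1 y.1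

end MAS

open MAS

theorem mem_filter_truncatedTree {d : ℕ} {x : M.Node} (hx : x.1.length ≤ d)
    {p : List ℕ → Bool} : x.code ∈ (truncatedTree M.encode d).filter p ↔ p x.code = true := by
  rw [List.mem_filter, and_iff_right (mem_truncatedTree.2 ⟨x, hx, rfl⟩)]

/-- Evaluation in the tree truncated at depth `d` is correct at the nodes that are at least as far
from the leaves as the formula is large. -/
theorem foldr_evalStep (d : ℕ) (φ : Formula (Fin k) (Fin m) (Fin v))
    (s : List (List (List ℕ))) :
    ∃ A, φ.encode.foldr (evalStep M.encode (truncatedTree M.encode d)) s = A :: s ∧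
      ∀ x : M.Node, x.1.length + φ.size ≤ d →
        (x.code ∈ A ↔ x ∈ φ.approx M 0 fun _ => ∅) := by
  have hlab : ∀ (x : M.Node) (p : Fin m),
      entry M.encode.2.2.2 (lastState M.encode x.code) p = true ↔ p ∈ M.label x.state := by
    intro x p
    rw [lastState_code]
    exact entry_matrixOf (fun q p => p ∈ M.label q) x.state p
  have hsucc : ∀ (x : M.Node), x.1.length + 1 ≤ d → ∀ w, (∃ q < n, w = q :: x.code ∧
      w ∈ truncatedTree M.encode d) ↔ ∃ y, M.Succ x y ∧ y.code = w := by
    intro x hx w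
    constructor
    · rintro ⟨q, hq, rfl, hw⟩
      obtain ⟨y, hy, hyw⟩ := mem_truncatedTree.1 hw
      refine ⟨y, ⟨⟨q, hq⟩, ?_⟩, hyw⟩
      apply List.map_injective_iff.2 Fin.val_injective
      apply List.reverse_injective
      simpa [Node.code] using hyw
    · rintro ⟨y, ⟨q, hq⟩, rfl⟩
      exact ⟨q, q.2, Node.code_of_append hq, mem_truncatedTree.2 ⟨y, by simpa [hq] using hx, rfl⟩⟩
  induction φ generalizing s with
  | prop p =>
    refine ⟨_, rfl, fun x hx => ?_⟩
    exact (mem_filter_truncatedTree (by omega)).trans (hlab x p)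
  | negProp p =>
    refine ⟨_, rfl, fun x hx => ?_⟩
    refine (mem_filter_truncatedTree (by omega)).trans ?_
    rw [Bool.not_eq_true', ← Bool.not_eq_true]
    exact not_congr (hlab x p)
  | var Z => exact ⟨_, rfl, fun x hx => by simp [applyOp, Formula.approx]⟩
  | and φ ψ ih₁ ih₂ =>
    obtain ⟨B, hB, hψ⟩ := ih₂ s
    obtain ⟨A, hA, hφ⟩ := ih₁ (B :: s)
    simp only [Formula.encode, List.foldr_cons, List.foldr_append, hB, hA]
    refine ⟨_, rfl, fun x hx => ?_⟩
    simp only [Formula.size] at hx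
    simp [applyOp, Formula.approx, hφ x (by omega), hψ x (by omega)]
  | or φ ψ ih₁ ih₂ =>
    obtain ⟨B, hB, hψ⟩ := ih₂ s
    obtain ⟨A, hA, hφ⟩ := ih₁ (B :: s)
    simp only [Formula.encode, List.foldr_cons, List.foldr_append, hB, hA]
    refine ⟨_, rfl, fun x hx => ?_⟩
    simp only [Formula.size] at hx
    simp [applyOp, Formula.approx, hφ x (by omega), hψ x (by omega)]
  | AX φ ih =>
    obtain ⟨A, hA, hφ⟩ := ih s
    simp only [Formula.encode, List.foldr_cons, hA]
    refine ⟨_, rfl, fun x hx => ?_⟩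
    simp only [Formula.size] at hx
    refine (mem_filter_truncatedTree (by omega)).trans ?_
    have h := hsucc x (by omega)
    simp only [List.all_eq_true, List.mem_range, Bool.or_eq_true, Bool.not_eq_true',
      ← Bool.not_eq_true, List.contains_iff_mem, ← imp_iff_not_or, List.headI]
    constructor
    · rintro hall y hy
      obtain ⟨q, hq, hw, hU⟩ := (h _).2 ⟨y, hy, rfl⟩
      have := hall q hq (hw ▸ hU)
      obtain ⟨r, hr⟩ := hy
      exact (hφ y (by rw [hr, List.length_append]; simp; omega)).1 (hw ▸ this)
    · intro hall q hq hU
      obtain ⟨y, hy, hyw⟩ := (h _).1 ⟨q, hq, rfl, hU⟩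
      have := hall y hy
      obtain ⟨r, hr⟩ := hy
      rw [← hyw]
      exact (hφ y (by rw [hr, List.length_append]; simp; omega)).2 this
  | EX φ ih =>
    obtain ⟨A, hA, hφ⟩ := ih s
    simp only [Formula.encode, List.foldr_cons, hA]
    refine ⟨_, rfl, fun x hx => ?_⟩
    simp only [Formula.size] at hx
    refine (mem_filter_truncatedTree (by omega)).trans ?_
    have h := hsucc x (by omega)
    simp only [List.any_eq_true, List.mem_range, Bool.and_eq_true, List.contains_iff_mem,
      List.headI]
    constructor
    · rintro ⟨q, hq, hU, hm⟩
      obtain ⟨y, hy, hyw⟩ := (h _).1 ⟨q, hq, rfl, hU⟩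
      refine ⟨y, hy, ?_⟩
      obtain ⟨r, hr⟩ := hy
      exact (hφ y (by rw [hr, List.length_append]; simp; omega)).1 (hyw ▸ hm)
    · rintro ⟨y, hy, hm⟩
      obtain ⟨q, hq, hw, hU⟩ := (h _).2 ⟨y, hy, rfl⟩
      refine ⟨q, hq, hw ▸ hU, ?_⟩
      obtain ⟨r, hr⟩ := hy
      exact hw ▸ (hφ y (by rw [hr, List.length_append]; simp; omega)).2 hm
  | know a φ ih =>
    obtain ⟨A, hA, hφ⟩ := ih s
    simp only [Formula.encode, List.foldr_cons, hA]
    refine ⟨_, rfl, fun x hx => ?_⟩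
    simp only [Formula.size] at hx
    refine (mem_filter_truncatedTree (by omega)).trans ?_
    have hlen : ∀ y, M.Indist a x y → y.1.length = x.1.length := fun y h => by
      simpa [Indist, observations] using (congrArg List.length h).symm
    simp only [List.all_eq_true, Bool.or_eq_true, Bool.not_eq_true',
      ← Bool.not_eq_true, List.contains_iff_mem, ← imp_iff_not_or, List.headI, beq_iff_eq]
    constructor
    · intro h y hy
      have hl := hlen y hy
      exact (hφ y (by omega)).1 (h _ (mem_truncatedTree.2 ⟨y, by omega, rfl⟩)
        (map_view_code_eq_iff.2 hy))
    · intro h u hu hv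
      obtain ⟨y, -, rfl⟩ := mem_truncatedTree.1 hu
      have hy := map_view_code_eq_iff.1 hv
      have hl := hlen y hy
      exact (hφ y (by omega)).2 (h y hy)
  | poss a φ ih =>
    obtain ⟨A, hA, hφ⟩ := ih s
    simp only [Formula.encode, List.foldr_cons, hA]
    refine ⟨_, rfl, fun x hx => ?_⟩
    simp only [Formula.size] at hx
    refine (mem_filter_truncatedTree (by omega)).trans ?_
    have hlen : ∀ y, M.Indist a x y → y.1.length = x.1.length := fun y h => by
      simpa [Indist, observations] using (congrArg List.length h).symm
    simp only [List.any_eq_true, Bool.and_eq_true, List.contains_iff_mem, List.headI, beq_iff_eq]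
    constructor
    · rintro ⟨u, hu, hv, hm⟩
      obtain ⟨y, -, rfl⟩ := mem_truncatedTree.1 hu
      have hy := map_view_code_eq_iff.1 hv
      have hl := hlen y hy
      exact ⟨y, hy, (hφ y (by omega)).1 hm⟩
    · rintro ⟨y, hy, hm⟩
      have hl := hlen y hy
      exact ⟨_, mem_truncatedTree.2 ⟨y, by omega, rfl⟩, map_view_code_eq_iff.2 hy,
        (hφ y (by omega)).2 hm⟩
  | mu Z φ ih =>
    obtain ⟨A, hA, -⟩ := ih s
    simp only [Formula.encode, List.foldr_cons, hA]
    exact ⟨_, rfl, fun x hx => by simp [applyOp, Formula.approx]⟩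
  | nu Z φ ih =>
    obtain ⟨A, hA, -⟩ := ih s
    simp only [Formula.encode, List.foldr_cons, hA]
    refine ⟨_, rfl, fun x hx => ?_⟩
    simpa [applyOp, Formula.approx] using mem_truncatedTree.2 ⟨x, by omega, rfl⟩

end Correctness

/-- A number of iterations after which the fixpoints of the coded formula are reached: the bound on
the number of colours for its size and the given numbers of states and agents. -/
def iterationBound (I : Input) : ℕ := growth^[(I.1.1.2.1 + 1) * I.2.2.length] I.1.1.1

/-- The code of the unrolled formula. -/
def unrollCode (I : Input) : List (ℕ × ℕ) := (I.2.2.foldr (unrollStep (iterationBound I)) []).headI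

/-- The algorithm: unroll the fixpoints and evaluate the result at the root of a truncated tree that
is deep enough, its depth being the size of the unrolled formula. -/
def modelCheck (I : Input) : Bool :=
  ((unrollCode I).foldr (evalStep I.1 (truncatedTree I.1 (unrollCode I).length)) []).headI.contains
    []

theorem modelCheck_encode {n k m v : ℕ} (M : MAS (Fin n) (Fin k) (Fin m))
    (φ : Formula (Fin k) (Fin m) (Fin v)) (hcl : φ.Closed) (hmix : φ.NonMixing M) :
    modelCheck (M.encode, v, φ.encode) = true ↔ φ.Holds M := by
  have hsem : ∀ ρ : Fin v → Set M.Node, φ.sem M ρ = φ.sem M fun _ => ∅ := fun ρ =>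
    Formula.sem_congr φ fun Z hZ => by
      rw [show φ.freeVars = ∅ from hcl] at hZ
      exact hZ.elim
  have happ := Formula.approx_eq_sem hcl hmix fun _ => ∅
  rw [← Formula.approx_zero_unroll] at happ
  simp only [Nat.card_eq_fintype_card, Fintype.card_fin] at happ
  -- The depth of the truncated tree is exactly what the root needs.
  obtain ⟨A, hA, h⟩ := foldr_evalStep (M := M) (φ.unroll (growth^[(k + 1) * φ.size] n)).size
    (φ.unroll (growth^[(k + 1) * φ.size] n)) []
  have h := h M.root (by simp [MAS.root])
  simp only [Formula.Holds, hsem, ← happ, ← h, forall_const]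
  simp only [modelCheck, unrollCode, iterationBound, Formula.foldr_unrollStep,
    Formula.length_encode, List.headI, show M.encode.1.2.1 = k from rfl,
    show M.encode.1.1 = n from rfl, hA, List.contains_iff_mem]
  rfl

/-! ### The algorithm is primitive recursive -/

section Primrec

variable {α β γ σ : Type*} [Primcodable α] [Primcodable β] [Primcodable γ] [Primcodable σ]

theorem primrec_filter {f : α → List β} {p : α → β → Bool} (hf : Primrec f) (hp : Primrec₂ p) :
    Primrec fun a => (f a).filter (p a) :=
  (Primrec.listFilterMap hf (g := fun a b => bif p a b then some b else none)
    (Primrec.cond hp (Primrec.option_some.comp Primrec.snd) (Primrec.const none))).of_eq fun a => by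
      rw [← List.filterMap_eq_filter]
      congr 1
      funext b
      cases h : p a b <;> simp [Option.guard, h]

theorem primrec_any {f : α → List β} {p : α → β → Bool} (hf : Primrec f) (hp : Primrec₂ p) :
    Primrec fun a => (f a).any (p a) :=
  (Primrec.list_foldr hf (Primrec.const false) (h := fun a bs => p a bs.1 || bs.2)
    (Primrec.or.comp (hp.comp Primrec.fst (Primrec.fst.comp Primrec.snd))
      (Primrec.snd.comp Primrec.snd))).of_eq fun a => by
    induction f a <;> simp_all

theorem primrec_all {f : α → List β} {p : α → β → Bool} (hf : Primrec f) (hp : Primrec₂ p) :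
    Primrec fun a => (f a).all (p a) :=
  (Primrec.list_foldr hf (Primrec.const true) (h := fun a bs => p a bs.1 && bs.2)
    (Primrec.and.comp (hp.comp Primrec.fst (Primrec.fst.comp Primrec.snd))
      (Primrec.snd.comp Primrec.snd))).of_eq fun a => by
    induction f a <;> simp_all

theorem primrec_beq [BEq β] [LawfulBEq β] {f g : α → β} (hf : Primrec f) (hg : Primrec g) :
    Primrec fun a => f a == g a :=
  by
  classical
  exact (Primrec.eq.decide.comp hf hg).of_eq fun a => by by_cases h : f a = g a <;> simp [h]

theorem primrec_contains [BEq β] [LawfulBEq β] {f : α → List β} {g : α → β} (hf : Primrec f)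
    (hg : Primrec g) : Primrec fun a => (f a).contains (g a) :=
  (primrec_any hf (p := fun a b => g a == b)
    (primrec_beq (hg.comp Primrec.fst) Primrec.snd)).of_eq fun _ => List.any_beq

theorem primrec_entry {A : α → List (List Bool)} {i j : α → ℕ} (hA : Primrec A) (hi : Primrec i)
    (hj : Primrec j) : Primrec fun a => entry (A a) (i a) (j a) :=
  (Primrec.list_getD false).comp ((Primrec.list_getD []).comp hA hi) hj

variable {S : α → SystemCode}

theorem primrec_lastState {w : α → List ℕ} (hS : Primrec S) (hw : Primrec w) :
    Primrec fun a => lastState (S a) (w a) :=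
  Primrec.option_getD.comp (Primrec.list_head?.comp hw)
    (Primrec.snd.comp (Primrec.snd.comp (Primrec.snd.comp (Primrec.fst.comp hS))))

theorem primrec_states (hS : Primrec S) : Primrec fun a => List.range (S a).1.1 :=
  Primrec.list_range.comp (Primrec.fst.comp (Primrec.fst.comp hS))

theorem primrec_label {q p : α → ℕ} (hS : Primrec S) (hq : Primrec q) (hp : Primrec p) :
    Primrec fun a => entry (S a).2.2.2 (q a) (p a) :=
  primrec_entry (Primrec.snd.comp (Primrec.snd.comp (Primrec.snd.comp hS))) hq hp

theorem primrec_truncatedTree {d : α → ℕ} (hS : Primrec S) (hd : Primrec d) :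
    Primrec fun a => truncatedTree (S a) (d a) := by
  refine Primrec.nat_iterate hd (Primrec.const [[]]) (h := fun a U => [] :: U.flatMap fun w =>
    ((List.range (S a).1.1).filter fun q => entry (S a).2.1 (lastState (S a) w) q).map
      fun q => q :: w) ?_
  refine Primrec.list_cons.comp (Primrec.const []) (Primrec.list_flatMap Primrec.snd ?_)
  have hS' : Primrec fun x : (α × List (List ℕ)) × List ℕ => S x.1.1 :=
    hS.comp (Primrec.fst.comp Primrec.fst)
  refine Primrec.list_map (primrec_filter (primrec_states hS') ?_)
    (Primrec.list_cons.comp Primrec.snd (Primrec.snd.comp Primrec.fst))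
  exact primrec_entry (Primrec.fst.comp (Primrec.snd.comp (hS'.comp Primrec.fst)))
    ((primrec_lastState hS' Primrec.snd).comp Primrec.fst) Primrec.snd

theorem primrec_view {b q : α → ℕ} (hS : Primrec S) (hb : Primrec b) (hq : Primrec q) :
    Primrec fun a => view (S a) (b a) (q a) := by
  refine Primrec.list_map (Primrec.list_range.comp
    (Primrec.fst.comp (Primrec.snd.comp (Primrec.snd.comp (Primrec.fst.comp hS))))) ?_
  have hS' : Primrec fun x : α × ℕ => S x.1 := hS.comp Primrec.fst
  exact Primrec.and.comp (primrec_label hS' (hq.comp Primrec.fst) Primrec.snd)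
    (primrec_entry (Primrec.fst.comp (Primrec.snd.comp (Primrec.snd.comp hS')))
      (hb.comp Primrec.fst) Primrec.snd)

theorem primrec_map_view {b : α → ℕ} {w : α → List ℕ} (hS : Primrec S) (hb : Primrec b)
    (hw : Primrec w) : Primrec fun a => (w a).map (view (S a) (b a)) :=
  Primrec.list_map hw (primrec_view (hS.comp Primrec.fst) (hb.comp Primrec.fst) Primrec.snd)

theorem primrec_applyOp {U A B : α → List (List ℕ)} {t : α → ℕ × ℕ} (hS : Primrec S)
    (hU : Primrec U) (ht : Primrec t) (hA : Primrec A) (hB : Primrec B) :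
    Primrec fun a => applyOp (S a) (U a) (t a) (A a) (B a) := by
  have hc : ∀ c : ℕ, PrimrecPred fun a => (t a).1 = c := fun c =>
    Primrec.eq.comp (Primrec.fst.comp ht) (Primrec.const c)
  have hi : Primrec fun a => (t a).2 := Primrec.snd.comp ht
  have h₁ : Primrec (Prod.fst : α × List ℕ → α) := Primrec.fst
  have h₂ : Primrec (Prod.fst ∘ Prod.fst : (α × List ℕ) × ℕ → α) := Primrec.fst.comp Primrec.fst
  have h₃ : Primrec (Prod.fst ∘ Prod.fst : (α × List ℕ) × List ℕ → α) :=
    Primrec.fst.comp Primrec.fst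
  have hlab : Primrec fun x : α × List ℕ =>
      entry (S x.1).2.2.2 (lastState (S x.1) x.2) (t x.1).2 :=
    primrec_label (hS.comp h₁) (primrec_lastState (hS.comp h₁) Primrec.snd) (hi.comp h₁)
  have hcons : Primrec fun x : (α × List ℕ) × ℕ => x.2 :: x.1.2 :=
    Primrec.list_cons.comp Primrec.snd (Primrec.snd.comp Primrec.fst)
  have hview : Primrec fun x : (α × List ℕ) × List ℕ =>
      (x.1.2.map (view (S x.1.1) (t x.1.1).2) == x.2.map (view (S x.1.1) (t x.1.1).2)) :=
    primrec_beq
      (primrec_map_view (hS.comp h₃) (hi.comp h₃) (Primrec.snd.comp Primrec.fst))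
      (primrec_map_view (hS.comp h₃) (hi.comp h₃) Primrec.snd)
  refine Primrec.ite (hc 0) (primrec_filter hU hlab) <|
    Primrec.ite (hc 1) (primrec_filter hU (Primrec.not.comp hlab)) <|
    Primrec.ite (hc 3) (primrec_filter hA
      (primrec_contains (f := fun x : α × List ℕ => B x.1) (hB.comp h₁) Primrec.snd)) <|
    Primrec.ite (hc 4) (Primrec.list_append.comp hA hB) <|
    Primrec.ite (hc 5) (primrec_filter hU (primrec_all (primrec_states (hS.comp h₁)) ?_)) <|
    Primrec.ite (hc 6) (primrec_filter hU (primrec_any (primrec_states (hS.comp h₁)) ?_)) <|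
    Primrec.ite (hc 7) (primrec_filter hU (primrec_all (hU.comp h₁) ?_)) <|
    Primrec.ite (hc 8) (primrec_filter hU (primrec_any (hU.comp h₁) ?_)) <|
    Primrec.ite (hc 10) hU (Primrec.const [])
  · exact Primrec.or.comp (Primrec.not.comp (primrec_contains (hU.comp h₂) hcons))
      (primrec_contains (hA.comp h₂) hcons)
  · exact Primrec.and.comp (primrec_contains (hU.comp h₂) hcons)
      (primrec_contains (hA.comp h₂) hcons)
  · exact Primrec.or.comp (Primrec.not.comp hview) (primrec_contains (hA.comp h₃) Primrec.snd)
  · exact Primrec.and.comp hview (primrec_contains (hA.comp h₃) Primrec.snd)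

theorem primrec_evalStep {U : α → List (List ℕ)} {t : α → ℕ × ℕ}
    {s : α → List (List (List ℕ))} (hS : Primrec S) (hU : Primrec U) (ht : Primrec t)
    (hs : Primrec s) : Primrec fun a => evalStep (S a) (U a) (t a) (s a) := by
  have hc : ∀ c : ℕ, PrimrecPred fun a => (t a).1 ≤ c := fun c =>
    Primrec.nat_le.comp (Primrec.fst.comp ht) (Primrec.const c)
  have htl := Primrec.list_tail.comp hs
  exact Primrec.list_cons.comp
    (primrec_applyOp hS hU ht (Primrec.list_headI.comp hs) (Primrec.list_headI.comp htl))
    (Primrec.ite (hc 2) hs (Primrec.ite (hc 4) (Primrec.list_tail.comp htl) htl))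

theorem primrec_substCode {Z : α → ℕ} {l c : α → List (ℕ × ℕ)} (hZ : Primrec Z) (hl : Primrec l)
    (hc : Primrec c) : Primrec fun a => substCode (Z a) (l a) (c a) :=
  Primrec.list_flatMap hl (Primrec.ite
    (Primrec.eq.comp Primrec.snd ((Primrec.const 2).pair (hZ.comp Primrec.fst)))
    (hc.comp Primrec.fst) (Primrec.list_cons.comp Primrec.snd (Primrec.const [])))

theorem primrec_unrollStep {N : α → ℕ} {t : α → ℕ × ℕ} {s : α → List (List (ℕ × ℕ))}
    (hN : Primrec N) (ht : Primrec t) (hs : Primrec s) :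
    Primrec fun a => unrollStep (N a) (t a) (s a) := by
  have hc : ∀ c : ℕ, PrimrecPred fun a => (t a).1 ≤ c := fun c =>
    Primrec.nat_le.comp (Primrec.fst.comp ht) (Primrec.const c)
  have hi : Primrec fun a => (t a).2 := Primrec.snd.comp ht
  have htl := Primrec.list_tail.comp hs
  have hhd := Primrec.list_headI.comp hs
  have hsing : ∀ {u : α → ℕ × ℕ}, Primrec u → Primrec fun a => [u a] := fun hu =>
    Primrec.list_cons.comp hu (Primrec.const [])
  refine Primrec.ite (hc 2) (Primrec.list_cons.comp (hsing ht) hs) <|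
    Primrec.ite (hc 4) (Primrec.list_cons.comp (Primrec.list_cons.comp ht
      (Primrec.list_append.comp hhd (Primrec.list_headI.comp htl)))
        (Primrec.list_tail.comp htl)) <|
    Primrec.ite (hc 8) (Primrec.list_cons.comp (Primrec.list_cons.comp ht hhd) htl) <|
    Primrec.list_cons.comp (Primrec.nat_iterate hN
      (Primrec.list_cons.comp ht (hsing ((Primrec.const 2).pair hi))) ?_) htl
  exact primrec_substCode (hi.comp Primrec.fst) (hhd.comp Primrec.fst) Primrec.snd

theorem primrec_growth : Primrec growth :=
  (Primrec.nat_iterate Primrec.id Primrec.id (h := fun _ t => t * 2)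
    (Primrec.nat_mul.comp Primrec.snd (Primrec.const 2))).of_eq fun t => by
      have : ∀ i s : ℕ, (fun t => t * 2)^[i] s = s * 2 ^ i := by
        intro i s
        induction i with
        | zero => simp
        | succ i ih => rw [Function.iterate_succ_apply', ih, pow_succ, mul_assoc]
      exact this t t

theorem primrec_iterationBound : Primrec iterationBound :=
  Primrec.nat_iterate
    (Primrec.nat_mul.comp
      (Primrec.succ.comp (Primrec.fst.comp (Primrec.snd.comp (Primrec.fst.comp Primrec.fst))))
      (Primrec.list_length.comp (Primrec.snd.comp Primrec.snd)))
    (Primrec.fst.comp (Primrec.fst.comp Primrec.fst)) (primrec_growth.comp Primrec.snd)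

theorem primrec_unrollCode : Primrec unrollCode :=
  Primrec.list_headI.comp <| Primrec.list_foldr (Primrec.snd.comp Primrec.snd) (Primrec.const [])
    (h := fun I ts => unrollStep (iterationBound I) ts.1 ts.2) <|
    primrec_unrollStep (primrec_iterationBound.comp Primrec.fst) (Primrec.fst.comp Primrec.snd)
      (Primrec.snd.comp Primrec.snd)

theorem primrec_modelCheck : Primrec modelCheck := by
  have hU : Primrec fun I : Input => truncatedTree I.1 (unrollCode I).length :=
    primrec_truncatedTree Primrec.fst (Primrec.list_length.comp primrec_unrollCode)
  have hstep : Primrec₂ fun (I : Input) (ts : (ℕ × ℕ) × List (List (List ℕ))) =>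
      evalStep I.1 (truncatedTree I.1 (unrollCode I).length) ts.1 ts.2 :=
    primrec_evalStep (Primrec.fst.comp Primrec.fst) (hU.comp Primrec.fst)
      (Primrec.fst.comp Primrec.snd) (Primrec.snd.comp Primrec.snd)
  have hval := Primrec.list_headI.comp
    (Primrec.list_foldr primrec_unrollCode (Primrec.const []) hstep)
  exact (primrec_contains hval (Primrec.const [])).of_eq fun _ => rfl

end Primrec

end EpistemicMu

theorem mainTheorem1 :
    ∃ decider : EpistemicMu.Input → Bool, Computable decider ∧
      ∀ (n k m v : ℕ) (M : EpistemicMu.MAS (Fin n) (Fin k) (Fin m))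
        (φ : EpistemicMu.Formula (Fin k) (Fin m) (Fin v)),
        φ.Closed → φ.NonMixing M →
          (decider (M.encode, v, φ.encode) = true ↔ φ.Holds M) :=
  ⟨EpistemicMu.modelCheck, EpistemicMu.primrec_modelCheck.to_comp,
    fun _ _ _ _ M φ hcl hmix => EpistemicMu.modelCheck_encode M φ hcl hmix⟩
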